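/- **Setting.** A *pregroup* is a set $P$ with an element $1$, an involution $\sigma$ and a partial multiplication defined on $D(P)\subseteq P\times P$, such that for all $x,y,z,t\in P$: $1x=x1=x$; $xx^\sigma=x^\sigma x=1$; if $(x,y)\in D(P)$ then $(y^\sigma,x^\sigma)\in D(P)$ and $(xy)^\sigma=y^\sigma x^\sigma$; if $(x,y),(y,z)\in D(P)$ then $(xy,z)\in D(P)$ iff $(x,yz)\in D(P)$, and then $(xy)z=x(yz)$; if $(x,y),(y,z),(z,t)\in D(P)$ then $(xy,z)\in D(P)$ or $(yz,t)\in D(P)$. Let $P$ be finite, $X=P\setminus\{1\}\neq\emptyset$, and let $\mathcal R\subset X^*$ be a finite set of cyclically $P$-reduced words (words of length at most $1$, or words in which no two cyclically consecutive letters form a pair in $D(P)$). These data form a finite pregroup presentation $\mathcal P=\langle X^\sigma\mid V_P\mid\mathcal R\rangle$ with $V_P=\{xy[xy]^\sigma : x,y\in X,\ (x,y)\in D(P),\ x\ne y^\sigma\}$; the universal group is $U(P)=\langle X\mid \{xx^\sigma : x\in X\}\cup V_P\rangle$. The inverse of a word is $(x_1\cdots x_n)^{-1}=x_n^\sigma\cdots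 x_1^\sigma$, and $\mathcal R^\pm=\mathcal R\cup\{R^{-1}:R\in\mathcal R\}$. Let $r$ be the length of the longest element of $\mathcal R$ ($r=0$ if $\mathcal R=\emptyset$), and let $\varepsilon>0$ be real. **Model.** Time is the number of elementary steps of a random access machine. Arithmetic on and comparisons of numbers (including $\varepsilon$ and curvature values) and of letters, products and inverses in $P$, operations on words of length at most six, and single accesses to arrays, lists and tables cost one step each; setting up a table costs its number of cells; each turn of a loop and leaving a loop cost one step each. The input consists of lists of the elements of $X$ and of $\mathcal R$ without repetitions. **The procedure** $\texttt{RSymVerify}(\mathcal P,\varepsilon)$. The colours are $\mathsf G$ (green) and $\mathsf R$ (red). First the relators are read and $r$ and $\mathcal R^\pm$ are computed. Then: 1. Compute the table of *intermult pairs* $(a,b)\in X^2$: $b\ne a^\sigma$, and $(a,b)\in D(P)$ or $(a,x),(x^\sigma,b)\in D(P)$ for some $x\in X$. 2. Write each $R\in\mathcal R^\pm$ as $w^k$ with $k$ maximal, trying all prefixes $w$, and list the *locations* $R(i,a,b)$: $1\le i\le|w|$, $b$ is the $i$-th letter of $w$ and $a$ the letter cyclically before it. 3. List the *places* $\mathbf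 P=(R(i,a,b),c,C)$ with $c\in X$. For $C=\mathsf R$ this is a place iff $(b^\sigma,c)$ is an intermult pair. For $C=\mathsf G$ it is a place iff some location $R'(j,b^\sigma,c)$ *instantiates* it, i.e. the label of $R'$ beginning at $b^\sigma$ is not the inverse of the label of $R$ ending at $b$ (two faces labelled $R,R'$ sharing the edge $b$ then form a $\sigma$-reduced diagram). For each green place store the list of these locations. 4. Compute the *vertex graph* $\mathcal G$. Its vertices are $(a,b,\mathsf G)$ for each location $R(i,a,b)$ (with the list of these locations) and $(a,b,\mathsf R)$ for each intermult pair $(a,b)$. Its edges are $(a,b,\mathsf G)\to(b^\sigma,c,\mathsf G)$ for each green place $(R(i,a,b),c,\mathsf G)$, and all $(a,b,\mathsf G)\to(b^\sigma,c,\mathsf R)$ and $(a,b,\mathsf R)\to(b^\sigma,c,\mathsf G)$. An edge has weight $1$ if its source is green, and $0$ otherwise. 5. By Dijkstra's algorithm (with a bucket queue) from every vertex, compute the least weight $w(\nu_2,\nu_1)\in\mathbb N\cup\{\infty\}$ of a path with at least one edge from $\nu_2$ to $\nu_1$. Tabulate $\texttt{Vertex}(\nu_1,\nu,\nu_2)$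 for all paths $\nu_1,\nu,\nu_2$ in $\mathcal G$ with $\nu$ green: for $\nu_1,\nu_2$ both green it is $-\frac16,-\frac14,-\frac3{10},-\frac13$ if $w(\nu_2,\nu_1)$ is $1,2,3,>3$; for $\nu_1$ green and $\nu_2$ red it is $0,-\frac16,-\frac14$ if $w(\nu_2,\nu_1)$ is $0,1,>1$; for $\nu_1$ red and $\nu_2$ green it is $0,-\frac16,-\frac14$ if $w(\nu_2,\nu_1)$ is $1,2,>2$; for both red it is $0$. 6. Find the $\mathcal R$-*letters* (letters occurring in $\mathcal R^\pm$) and the list $\mathcal B$ of cyclic words $w$ with $3\le|w|\le6$ that are $1$ in $U(P)$, have no proper nonempty subword that is $1$ in $U(P)$, have only intermult pairs as consecutive letters, and contain at most one non-$\mathcal R$-letter, and none if $|w|>4$. To do so, enumerate the words of length $3,4,5$ with consecutive letters intermulting; a word $u$ of length $5$ that equals a letter $a$ in $U(P)$ also gives the candidate $ua^\sigma$; equality in $U(P)$ is tested by $P$-reduction. Tabulate, for each $(a,b,c)$ such that $abc$ is a cyclic subword of a word $w\in\mathcal B$, the value $\texttt{Blob}(a,b,c)$: the maximum over these $w$ of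 $-\frac16,-\frac14,-\frac3{10},-\frac13$ for $|w|=3,4,5,6$ if $w$ has only $\mathcal R$-letters, and of $-\frac14,-\frac13$ for $|w|=3,4$ otherwise. For other $(a,b,c)$, $\texttt{Blob}(a,b,c)$ is $-\frac5{14}$ if at least one of $a,c$ is an $\mathcal R$-letter, and $-\frac12$ otherwise. 7. For each place $\mathbf P=(R(i,a,b),c,C)$ with $R\in\mathcal R$ compute a list $\texttt{OneStep}(\mathbf P)$ of triples $(\mathbf Q,l,\chi)$, where $\mathbf Q$ is a place on $R$ at distance $l$ from $\mathbf P$, $1\le l<|R|$, keeping for each $(\mathbf Q,l)$ only the largest $\chi$. - If $C=\mathsf R$: for each place $\mathbf Q=(R(i+1,b,d),x,C')$ and each $y$ that intermults with $b^\sigma$, include $(\mathbf Q,1,\chi_1+\chi_2)$, where $\chi_1=\texttt{Blob}(y,b^\sigma,c)$ and $\chi_2=\texttt{Vertex}((y,b^\sigma,\mathsf R),(b,d,\mathsf G),(d^\sigma,x,C'))$. - If $C=\mathsf G$: for each location on some $R'$ instantiating $\mathbf P$, each common consolidated edge $\alpha$ (not necessarily maximal) of $R$ and $R'$ starting there, of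 length $l$ with $1\le l<|R|$ and $l\le|R'|$, and each place $\mathbf P'=(R(i+l,d,e),x,C')$ at its end, let $y$ be the letter of $R'$ before the letter $d^\sigma$ at the end of $\alpha$ and put $\chi'=\texttt{Vertex}((y,d^\sigma,\mathsf G),(d,e,\mathsf G),(e^\sigma,x,C'))$. If $C'=\mathsf G$, include $(\mathbf P',l,\chi')$. If $C'=\mathsf R$, then for each place $\mathbf Q$ one letter after $\mathbf P'$ include all $(\mathbf Q,l+1,\chi'+\chi_1+\chi_2)$, with $\chi_1,\chi_2$ obtained from $\mathbf P',\mathbf Q$ as in the case $C=\mathsf R$. 8. Let $\zeta=\min(\lceil6(1+\varepsilon)\rceil-1,\,r)$. For each place $\mathbf P_s$ on each $R\in\mathcal R$, run $\texttt{RSymVerifyAtPlace}(\mathbf P_s,\varepsilon)$: start with $L=[(\mathbf P_s,0,0,0)]$; for $i=1,\dots,\zeta$, for each $(\mathbf P,l,k,\psi)\in L$ with $k=i-1$ and each $(\mathbf Q,l',\chi)\in\texttt{OneStep}(\mathbf P)$ with $l+l'\le|R|$, put $\psi'=\psi+\chi+(1+\varepsilon)l'/|R|$. If $\psi'<0$,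 or if $l+l'=|R|$ and $\mathbf Q\ne\mathbf P_s$, do nothing; else if $\psi'>0$, $\mathbf Q=\mathbf P_s$ and $l+l'=|R|$, return $\texttt{fail}$ and $L$ (which ends the whole procedure with this output); else include $(\mathbf Q,l+l',i,\psi')$ in $L$, i.e. append it if $L$ has no entry $(\mathbf Q,l+l',j,\psi'')$, and let it replace such an entry if $\psi'>\psi''$. 9. Return $\texttt{true}$. **Theorem.** There is an absolute constant $C$ such that, for all $P$, $\mathcal P$ and $\varepsilon>0$ as above, the number of steps of $\texttt{RSymVerify}(\mathcal P,\varepsilon)$ is at most $$C\,(1+\varepsilon)\,\bigl(|X|^5+r^3|X|^4|\mathcal R|^2\bigr).$$ In particular, for each fixed $\varepsilon$ (and uniformly for bounded $\varepsilon$), $\texttt{RSymVerify}(\mathcal P,\varepsilon)$ runs in time $O(|X|^5+r^3|X|^4|\mathcal R|^2)$. -/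

import Mathlib

namespace RSym

/-! ### Pregroups and pregroup presentations -/

/-- A pregroup (in the sense of Stallings) on the set `P`: a distinguished element, an involution
`inv` (written `σ` in the literature) and a partial multiplication.  `mul x y = some z` means that
`(x, y)` lies in the domain `D(P)` and that the product is `z`; `mul x y = none` means that
`(x, y)` does not lie in `D(P)`. -/
class Pregroup (P : Type) where
  one : P
  inv : P → P
  mul : P → P → Option P
  inv_inv : ∀ x, inv (inv x) = x
  /-- (P1) -/
  one_mul : ∀ x, mul one x = some x
  mul_one : ∀ x, mul x one = some x
  /-- (P2) -/
  mul_inv : ∀ x, mul x (inv x) = some one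
  inv_mul : ∀ x, mul (inv x) x = some one
  /-- (P3) -/
  inv_mul_rev : ∀ x y z, mul x y = some z → mul (inv y) (inv x) = some (inv z)
  /-- (P4): if `xy` and `yz` are defined, then `(xy)z` is defined iff `x(yz)` is,
  and then they are equal. -/
  assoc : ∀ x y z u v, mul x y = some u → mul y z = some v → mul u z = mul x v
  /-- (P5) -/
  dom_or_dom : ∀ x y z t u v w, mul x y = some u → mul y z = some v → mul z t = some w →
    (mul u z).isSome ∨ (mul v t).isSome

/-- The domain `D(P)` of the multiplication. -/
def Dom {P : Type} [Pregroup P] (x y : P) : Prop := (Pregroup.mul x y).isSome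

/-- A word is `P`-reduced if no two consecutive letters can be multiplied in `P`. -/
def PReduced {P : Type} [Pregroup P] (w : List P) : Prop := w.IsChain (fun x y => ¬ Dom x y)

/-- Cyclically `P`-reduced words. -/
def CyclicallyPReduced {P : Type} [Pregroup P] (w : List P) : Prop :=
  w.length ≤ 1 ∨ (PReduced w ∧ ∀ x ∈ w.getLast?, ∀ y ∈ w.head?, ¬ Dom x y)

/-- A finite pregroup presentation `⟨X^σ | V_P | 𝓡⟩`, as it is given to an algorithm: a list of the
elements of `X = P \ {1}` and a list of the elements of `𝓡`, a finite set of cyclically `P`-reduced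
words over `X`, both without repetitions.  (`X`, `σ` and `V_P` are determined by the pregroup.) -/
structure PregroupPresentation (P : Type) [Pregroup P] where
  letters : List P
  letters_nodup : letters.Nodup
  mem_letters : ∀ x, x ∈ letters ↔ x ≠ Pregroup.one
  relators : List (List P)
  relators_nodup : relators.Nodup
  relators_letters : ∀ R ∈ relators, ∀ x ∈ R, x ≠ Pregroup.one
  relators_reduced : ∀ R ∈ relators, CyclicallyPReduced R

/-- The length of the longest relator. -/
def PregroupPresentation.maxLength {P : Type} [Pregroup P] (𝔓 : PregroupPresentation P) : ℕ :=
  (𝔓.relators.map List.length).foldr max 0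

/-! ### The model of computation

Programs for a unit-cost random access machine.  A program of type `Timed α` produces a value and a
number of elementary steps.  Cost arises only in the primitives below; sequencing (`do`), branching
on a computed value and naming a value are control flow.  Data are only touched through
* `op e`: one elementary operation: arithmetic on or comparison of numbers or letters, a product
  or an inverse in the pregroup, a read from or a push onto an array or a list, taking a field of a
  record or building one, an operation on a word of length at most six;
* `newTable`, `get`, `set`: tables with random access; a new table costs as much as it has cells;
* the loops `forEach` and `forUntil`, which charge one step for each turn and one for leaving. -/

/-- A computation with result `val` that takes `time` steps. -/
structure Timed (α : Type) where
  val : α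
  time : ℕ

instance : Monad Timed where
  pure a := ⟨a, 0⟩
  bind x f := ⟨(f x.val).val, x.time + (f x.val).time⟩

/-- One elementary operation. -/
def op {α : Type} (a : α) : Timed α := ⟨a, 1⟩

/-- A table with entries in `v`, indexed by (finitely many) keys in `κ`. -/
abbrev Table (κ v : Type) : Type := κ → v

/-- Set up a table with `size` cells, all holding `a`. -/
def newTable {κ v : Type} (size : ℕ) (a : v) : Timed (Table κ v) := ⟨fun _ => a, size⟩

/-- Read a cell. -/
def get {κ v : Type} (T : Table κ v) (k : κ) : Timed v := op (T k)

/-- Write a cell. -/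
def set {κ v : Type} [DecidableEq κ] (T : Table κ v) (k : κ) (a : v) : Timed (Table κ v) :=
  op (Function.update T k a)

/-- `for x in l do body`, with state `s`. -/
def forEach {α σ : Type} : List α → σ → (σ → α → Timed σ) → Timed σ
  | [], s, _ => op s
  | x :: l, s, body => do
    let _ ← op ()
    let t ← body s x
    forEach l t body

/-- `for x in l do body`, where the body may stop everything with an error `e : ρ`. -/
def forUntil {α σ ρ : Type} :
    List α → σ → (σ → α → Timed (Except ρ σ)) → Timed (Except ρ σ)
  | [], s, _ => op (.ok s)
  | x :: l, s, body => do
    let _ ← op ()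
    let t ← body s x
    match t with
    | .error e => pure (.error e)
    | .ok t => forUntil l t body

/-! ### Letters and words -/

section Procedure

/-- The colour of a face: green (labelled by a relator) or red (part of a red blob). -/
inductive Colour
  | green
  | red
deriving DecidableEq

/-- The two colours, to loop over. -/
def colours : List Colour := [.green, .red]

variable {P : Type} [DecidableEq P] [Pregroup P]

/-- The involution. -/
def sigma (x : P) : Timed P := op (Pregroup.inv x)

/-- Test whether `(x, y) ∈ D(P)`. -/
def domT (x y : P) : Timed Bool := op (Pregroup.mul x y).isSome

/-- The letter of the cyclic word `w` at position `p` (positions count from `0`). -/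
def letterAt (w : Array P) (p : ℕ) : Timed P := op (w.getD (p % w.size) Pregroup.one)

/-- The word with number `k`. -/
def wordAt (S : Array (Array P)) (k : ℕ) : Timed (Array P) := op (S.getD k #[])

/-- Equality of words. -/
def eqWord (u v : Array P) : Timed Bool := do
  let e ← op (decide (u.size = v.size))
  if e then
    forEach (List.range u.size) true fun ok t => do
      let x ← letterAt u t
      let y ← letterAt v t
      op (ok && decide (x = y))
  else pure false

/-- The inverse word. -/
def invWord (w : Array P) : Timed (Array P) :=
  forEach (List.range w.size) #[] fun v t => do
    let x ← letterAt w (w.size - 1 - t)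
    let y ← sigma x
    op (v.push y)

/-- Read the relators into arrays. -/
def loadRelators (rels : List (List P)) : Timed (Array (Array P)) :=
  forEach rels #[] fun A w => do
    let v ← forEach w #[] fun v x => op (v.push x)
    op (A.push v)

/-- The length of the longest word. -/
def longest (S : Array (Array P)) : Timed ℕ :=
  forEach (List.range S.size) 0 fun r k => do
    let w ← wordAt S k
    op (max r w.size)

/-- From `𝓡` to `𝓡^± = 𝓡 ∪ {R⁻¹ : R ∈ 𝓡}`: the elements of `𝓡` keep the numbers
`0, …, |𝓡| - 1`, and the inverses which are not there yet are appended. -/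
def symmetrise (A : Array (Array P)) : Timed (Array (Array P)) :=
  forEach (List.range A.size) A fun S k => do
    let w ← wordAt S k
    let v ← invWord w
    let found ← forEach (List.range S.size) false fun f j => do
      let u ← wordAt S j
      let e ← eqWord u v
      op (f || e)
    if found then pure S else op (S.push v)

/-! ### Step 1: intermult pairs -/

/-- `a` intermults with `b` if `b ≠ a^σ` and either `(a, b) ∈ D(P)` or there is `x ∈ X` with
`(a, x), (x^σ, b) ∈ D(P)`.  The table of all such pairs. -/
def intermultTable (X : List P) : Timed (Table (P × P) Bool) := do
  let T ← newTable (X.length * X.length) false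
  forEach X T fun T a => forEach X T fun T b => do
    let a' ← sigma a
    let e ← op (decide (b = a'))
    if e then pure T
    else do
      let d ← domT a b
      if d then set T (a, b) true
      else do
        let found ← forEach X false fun f x => do
          let p ← domT a x
          let x' ← sigma x
          let q ← domT x' b
          op (f || (p && q))
        if found then set T (a, b) true else pure T

/-! ### Step 2: roots and locations -/

/-- The length of the word `w` for which `R = w ^ k` with `k` maximal (`0` if `R` is empty). -/
def rootLength (R : Array P) : Timed ℕ := do
  let best ← forEach (List.range R.size) none fun best l₀ =>
    match best with
    | some l => pure (some l)
    | none => do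
      let l ← op (l₀ + 1)
      let d ← op (decide (R.size % l = 0))
      if d then do
        let ok ← forEach (List.range R.size) true fun ok t => do
          let x ← letterAt R t
          let y ← letterAt R (t % l)
          op (ok && decide (x = y))
        if ok then op (some l) else pure none
      else pure none
  match best with
  | some l => pure l
  | none => pure 0

/-- The location `R(i, a, b)`: `rel` is the number of the relator `R = w ^ k` in the array for
`𝓡^±`, `pos < |w|` is the position of the letter `b` (counted from `0`), and `a` is the letter
cyclically before it. -/
structure Loc (P : Type) where
  rel : ℕ
  pos : ℕ
  a : P
  b : P

/-- The root lengths of all relators, and all locations. -/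
def findLocations (S : Array (Array P)) : Timed (Array ℕ × List (Loc P)) :=
  forEach (List.range S.size) (#[], []) fun (roots, locs) k => do
    let R ← wordAt S k
    let l ← rootLength R
    let roots ← op (roots.push l)
    let locs ← forEach (List.range l) locs fun locs p => do
      let a ← letterAt R (p + R.size - 1)
      let b ← letterAt R p
      op (⟨k, p, a, b⟩ :: locs)
    pure (roots, locs)

/-! ### Step 3: places -/

/-- For locations `R(i, a, b)` and `R'(j, b^σ, c)`: test whether the label of `R'` that begins at
`b^σ` is the inverse of the label of `R` that ends at `b`, that is, whether two faces labelled `R`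
and `R'` that share the edge labelled `b` violate `σ`-reducedness. -/
def mutuallyInverse (S : Array (Array P)) (ρ ρ' : Loc P) : Timed Bool := do
  let R ← wordAt S ρ.rel
  let R' ← wordAt S ρ'.rel
  let e ← op (decide (R.size = R'.size))
  if e then
    forEach (List.range R.size) true fun ok t => do
      let x ← letterAt R (ρ.pos + t)
      let y ← letterAt R' (ρ'.pos + 2 * R'.size - 1 - t)
      let x' ← sigma x
      op (ok && decide (y = x'))
  else pure false

/-- A place `(R(i, a, b), c, C)`. -/
structure Place (P : Type) where
  loc : Loc P
  c : P
  col : Colour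

/-- The places: a list of all of them, the same as a table (indexed by relator, position, letter,
colour), and for each green place `(R(i, a, b), c, G)` the list of the locations `R'(j, b^σ, c)`
which instantiate it. -/
structure PlaceData (P : Type) where
  places : List (Place P)
  isPlace : Table (ℕ × ℕ × P × Colour) Bool
  inst : Table (ℕ × ℕ × P) (List (Loc P))

/-- The potential place `(R(i, a, b), c, R)` is a place iff `(b^σ, c)` is an intermult pair, and
`(R(i, a, b), c, G)` is a place iff there is a location `R'(j, b^σ, c)` such that the diagram with
two faces labelled `R` and `R'` that share the edge labelled `b` is `σ`-reduced. -/
def findPlaces (X : List P) (S : Array (Array P)) (r : ℕ) (im : Table (P × P) Bool)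
    (locs : List (Loc P)) : Timed (PlaceData P) := do
  let isPlace ← newTable (S.size * r * X.length * 2) false
  let inst ← newTable (S.size * r * X.length) []
  forEach locs ⟨[], isPlace, inst⟩ fun D ρ => do
    let b' ← sigma ρ.b
    let nbrs ← forEach locs [] fun N ρ' => do
      let e ← op (decide (ρ'.a = b'))
      if e then do
        let m ← mutuallyInverse S ρ ρ'
        if m then pure N else op (ρ' :: N)
      else pure N
    forEach X D fun D c => do
      let t ← get im (b', c)
      let D ← if t then do
          let isPlace ← set D.isPlace (ρ.rel, ρ.pos, c, .red) true
          let places ← op (⟨ρ, c, .red⟩ :: D.places)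
          pure { D with places := places, isPlace := isPlace }
        else pure D
      let N ← forEach nbrs [] fun N ρ' => do
        let e ← op (decide (ρ'.b = c))
        if e then op (ρ' :: N) else pure N
      let none_found ← op N.isEmpty
      if none_found then pure D
      else do
        let isPlace ← set D.isPlace (ρ.rel, ρ.pos, c, .green) true
        let places ← op (⟨ρ, c, .green⟩ :: D.places)
        let inst ← set D.inst (ρ.rel, ρ.pos, c) N
        pure ⟨places, isPlace, inst⟩

/-! ### Step 4: the vertex graph -/

/-- The type of the vertices `(a, b, C)` of the vertex graph. -/
abbrev GVertex (P : Type) : Type := P × P × Colour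

/-- The vertex graph: which triples `(a, b, C)` are vertices; `edge ((a, b, C), c, C')` says whether
there is an edge from `(a, b, C)` to `(b^σ, c, C')` (all edges have this shape); and the list of the
locations `R(i, a, b)` for each green vertex `(a, b, G)`.  An edge has weight `1` if its source is
green and weight `0` if its source is red. -/
structure VertexGraph (P : Type) where
  vertex : Table (GVertex P) Bool
  edge : Table (GVertex P × P × Colour) Bool
  locsAt : Table (P × P) (List (Loc P))

/-- Compute the vertex graph.  The edges between green vertices come from the green places. -/
def vertexGraph (X : List P) (im : Table (P × P) Bool) (locs : List (Loc P))
    (places : List (Place P)) : Timed (VertexGraph P) := do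
  let V ← newTable (X.length ^ 2 * 2) false
  let A ← newTable (X.length ^ 2) []
  let (V, A) ← forEach locs (V, A) fun (V, A) ρ => do
    let V ← set V (ρ.a, ρ.b, .green) true
    let old ← get A (ρ.a, ρ.b)
    let A ← set A (ρ.a, ρ.b) (ρ :: old)
    pure (V, A)
  let V ← forEach X V fun V a => forEach X V fun V b => do
    let t ← get im (a, b)
    if t then set V (a, b, .red) true else pure V
  let E ← newTable (X.length ^ 3 * 4) false
  let E ← forEach places E fun E p => do
    let g ← op (decide (p.col = .green))
    if g then set E ((p.loc.a, p.loc.b, .green), p.c, .green) true else pure E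
  let E ← forEach X E fun E a => forEach X E fun E b => do
    let b' ← sigma b
    forEach X E fun E c => do
      let s ← get V (a, b, .green)
      let t ← get V (b', c, .red)
      let E ← if s && t then set E ((a, b, .green), c, .red) true else pure E
      let s ← get V (a, b, .red)
      let t ← get V (b', c, .green)
      if s && t then set E ((a, b, .red), c, .green) true else pure E
  pure ⟨V, E, A⟩

/-! ### Step 5: path weights and the function `Vertex` -/

/-- The state of Dijkstra's algorithm with a bucket queue: tentative distances, finished vertices,
the current distance, the bucket of vertices waiting at this distance, and the bucket of vertices
waiting at the next distance. -/
structure DijkstraState (P : Type) where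
  dist : Table (GVertex P) (Option ℕ)
  finished : Table (GVertex P) Bool
  d : ℕ
  cur : List (GVertex P)
  next : List (GVertex P)

/-- Relax all edges that leave `u`, a vertex at the current distance. -/
def relax (X : List P) (E : Table (GVertex P × P × Colour) Bool) (u : GVertex P)
    (st : DijkstraState P) : Timed (DijkstraState P) := do
  let b' ← sigma u.2.1
  let isGreen ← op (decide (u.2.2 = .green))
  let nd ← op (if isGreen then st.d + 1 else st.d)
  forEach X st fun st c => forEach colours st fun st C => do
    let e ← get E (u, c, C)
    if e then do
      let old ← get st.dist (b', c, C)
      let better ← op (match old with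
        | none => true
        | some d => decide (nd < d))
      if better then do
        let dist ← set st.dist (b', c, C) (some nd)
        if isGreen then do
          let next ← op ((b', c, C) :: st.next)
          pure { st with dist := dist, next := next }
        else do
          let cur ← op ((b', c, C) :: st.cur)
          pure { st with dist := dist, cur := cur }
      else pure st
    else pure st

/-- Dijkstra's algorithm: the smallest weights of the paths with at least one edge that start at
`s` (`none` if there is no such path).  A vertex enters the queue at most twice, so that after
`4 · (2|X|²)` turns the queue is empty. -/
def dijkstra (X : List P) (E : Table (GVertex P × P × Colour) Bool) (s : GVertex P) :
    Timed (Table (GVertex P) (Option ℕ)) := do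
  let dist ← newTable (X.length ^ 2 * 2) none
  let fin ← newTable (X.length ^ 2 * 2) false
  let st ← relax X E s ⟨dist, fin, 0, [], []⟩
  let st ← forEach (List.range (4 * (2 * X.length ^ 2) + 1)) st fun st _ =>
    match st.cur with
    | u :: rest => do
      let seen ← get st.finished u
      if seen then op { st with cur := rest }
      else do
        let fin ← set st.finished u true
        relax X E u { st with cur := rest, finished := fin }
    | [] =>
      match st.next with
      | [] => pure st
      | u :: rest => op { st with cur := u :: rest, next := [], d := st.d + 1 }
  pure st.dist

/-- `w(ν₂, ν₁)` for all pairs of vertices of the vertex graph, as a table of rows. -/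
def pathWeights (X : List P) (G : VertexGraph P) :
    Timed (Table (GVertex P) (Table (GVertex P) (Option ℕ))) := do
  let W ← newTable (X.length ^ 2 * 2) fun _ => none
  forEach X W fun W a => forEach X W fun W b => forEach colours W fun W C => do
    let v ← get G.vertex (a, b, C)
    if v then do
      let row ← dijkstra X G.edge (a, b, C)
      set W (a, b, C) row
    else pure W

/-- The value of `Vertex(ν₁, ν, ν₂)` in terms of the colours of `ν₁` and `ν₂` and of
`w(ν₂, ν₁)`. -/
def vertexBound {K : Type} [Field K] : Colour → Colour → Option ℕ → K
  | .green, .green, some 1 => -1 / 6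
  | .green, .green, some 2 => -1 / 4
  | .green, .green, some 3 => -3 / 10
  | .green, .green, _ => -1 / 3
  | .green, .red, some 0 => 0
  | .green, .red, some 1 => -1 / 6
  | .green, .red, _ => -1 / 4
  | .red, .green, some 1 => 0
  | .red, .green, some 2 => -1 / 6
  | .red, .green, _ => -1 / 4
  | .red, .red, _ => 0

/-- The index of the path `(y, a^σ, C₁), (a, b, G), (b^σ, c, C₂)` of the vertex graph is
`(y, C₁, a, b, c, C₂)`. -/
abbrev VertexTable (K P : Type) : Type := Table (P × Colour × P × P × P × Colour) K

/-- The table of the function `Vertex`: its values at all directed paths `ν₁, ν, ν₂` of the vertex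
graph with `ν` green. -/
def vertexTable {K : Type} [Field K] (X : List P) (G : VertexGraph P) :
    Timed (VertexTable K P) := do
  let W ← pathWeights X G
  let T ← newTable (X.length ^ 4 * 4) 0
  forEach X T fun T a => forEach X T fun T b => do
    let v ← get G.vertex (a, b, .green)
    if v then do
      let a' ← sigma a
      let b' ← sigma b
      forEach X T fun T y => forEach colours T fun T C₁ => do
        let e ← get G.edge ((y, a', C₁), b, .green)
        if e then
          forEach X T fun T c => forEach colours T fun T C₂ => do
            let e ← get G.edge ((a, b, .green), c, C₂)
            if e then do
              let row ← get W (b', c, C₂)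
              let w ← get row (y, a', C₁)
              let χ ← op (vertexBound C₁ C₂ w)
              set T (y, C₁, a, b, c, C₂) χ
            else pure T
        else pure T
    else pure T

/-- `Vertex(ν₁, ν, ν₂)`. -/
def vertexFn {K : Type} (T : VertexTable K P) (ν₁ ν ν₂ : GVertex P) : Timed K :=
  get T (ν₁.1, ν₁.2.2, ν.1, ν.2.1, ν₂.2.1, ν₂.2.2)

/-! ### Step 6: the list `𝓑` and the function `Blob` -/

/-- The table of the `𝓡`-letters: the letters that occur in an element of `𝓡^±`. -/
def rLetters (X : List P) (S : Array (Array P)) : Timed (Table P Bool) := do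
  let T ← newTable X.length false
  forEach (List.range S.size) T fun T k => do
    let w ← wordAt S k
    forEach (List.range w.size) T fun T p => do
      let x ← letterAt w p
      set T x true

/-- Put the letter `x` on top of a `P`-reduced word, kept as a stack with its last letter on top,
and multiply as long as possible. -/
def pushLetter (x : P) : List P → Timed (List P)
  | [] => op [x]
  | y :: s => do
    let m ← op (Pregroup.mul y x)
    match m with
    | none => op (x :: y :: s)
    | some z => do
      let e ← op (decide (z = Pregroup.one))
      if e then pure s else pushLetter z s

/-- A `P`-reduced word (read from its end) that is equal to `w` in the universal group `U(P)`.
The word `w` is equal to `1` in `U(P)` iff the result is the empty word, and equal to the letter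
`a` iff the result is the word `a`. -/
def reduceWord (w : List P) : Timed (List P) :=
  forEach w [] fun s x => pushLetter x s

/-- Test whether some proper nonempty subword of the cyclic word `w` is equal to `1` in `U(P)`. -/
def hasTrivialSubword (w : List P) : Timed Bool :=
  forEach (List.range w.length) false fun f i =>
    forEach (List.range (w.length - 1)) f fun f m => do
      let u ← op ((w.rotate i).take (m + 1))
      let s ← reduceWord u
      op (f || s.isEmpty)

/-- The curvature of a simply connected red blob of boundary length `l`, one edge of which lies on
the boundary of the diagram if `bd` holds, and none otherwise. -/
def blobCurvature {K : Type} [Field K] (l : ℕ) (bd : Bool) : K :=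
  match l, bd with
  | 3, false => -1 / 6
  | 3, true => -1 / 4
  | 4, false => -1 / 4
  | 4, true => -1 / 3
  | 5, _ => -3 / 10
  | _, _ => -1 / 3

/-- The list `𝓑`, and for each triple of letters the maximal curvature over the words in `𝓑` that
have it as a cyclic subword. -/
structure BlobData (K P : Type) where
  words : List (List P)
  best : Table (P × P × P) (Option K)

/-- Test whether the cyclic word `w`, of length between `3` and `6`, belongs to `𝓑`:
consecutive letters intermult, there is at most one letter that is not an `𝓡`-letter, and none if
`|w| > 4`, the word is equal to `1` in `U(P)` and no proper nonempty subword is.  If so, record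
it. -/
def tryWord {K : Type} [Field K] [LinearOrder K] (im : Table (P × P) Bool) (rl : Table P Bool)
    (B : BlobData K P) (w : List P) : Timed (BlobData K P) := do
  let l ← op w.length
  let ok ← forEach (List.range l) true fun ok i => do
    let x ← op (w.getD i Pregroup.one)
    let y ← op (w.getD ((i + 1) % l) Pregroup.one)
    let t ← get im (x, y)
    op (ok && t)
  let bad ← forEach w 0 fun k x => do
    let t ← get rl x
    op (if t then k else k + 1)
  let few ← op (decide (bad = 0 ∨ bad = 1 ∧ l ≤ 4))
  if ok && few then do
    let s ← reduceWord w
    let sub ← hasTrivialSubword w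
    if s.isEmpty && !sub then do
      let χ ← op (blobCurvature l (decide (bad ≠ 0)))
      let words ← op (w :: B.words)
      let best ← forEach (List.range l) B.best fun best i => do
        let x ← op (w.getD i Pregroup.one)
        let y ← op (w.getD ((i + 1) % l) Pregroup.one)
        let z ← op (w.getD ((i + 2) % l) Pregroup.one)
        let old ← get best (x, y, z)
        let new ← op (match old with
          | none => χ
          | some χ' => max χ χ')
        set best (x, y, z) (some new)
      pure ⟨words, best⟩
    else pure B
  else pure B

/-- Treat a word in which consecutive letters intermult: if its length is `3`, `4` or `5`, try it;
if its length is `5` and it is equal in `U(P)` to a single letter `a`, try the word of length `6`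
which is obtained by appending `a^σ`. -/
def treatWord {K : Type} [Field K] [LinearOrder K] (im : Table (P × P) Bool) (rl : Table P Bool)
    (B : BlobData K P) (w : List P) : Timed (BlobData K P) := do
  let long ← op (decide (3 ≤ w.length))
  if long then do
    let B ← tryWord im rl B w
    let five ← op (decide (w.length = 5))
    if five then do
      let s ← reduceWord w
      match s with
      | [a] => do
        let a' ← sigma a
        let w' ← op (w ++ [a'])
        tryWord im rl B w'
      | _ => pure B
    else pure B
  else pure B

/-- Run through all the words of length at most `|w| + k` that properly extend `w`, adding only
letters such that consecutive letters intermult. -/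
def enumWords {K : Type} [Field K] [LinearOrder K] (X : List P) (im : Table (P × P) Bool)
    (rl : Table P Bool) : ℕ → List P → BlobData K P → Timed (BlobData K P)
  | 0, _, B => pure B
  | k + 1, w, B => forEach X B fun B x => do
    let ok ← match w.getLast? with
      | none => pure true
      | some z => get im (z, x)
    if ok then do
      let w' ← op (w ++ [x])
      let B ← treatWord im rl B w'
      enumWords X im rl k w' B
    else pure B

/-- Compute `𝓑` and the table for the function `Blob`. -/
def findBlobs {K : Type} [Field K] [LinearOrder K] (X : List P) (im : Table (P × P) Bool)
    (rl : Table P Bool) : Timed (BlobData K P) := do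
  let best ← newTable (X.length ^ 3) none
  enumWords X im rl 5 [] ⟨[], best⟩

/-- `Blob(a, b, c)`. -/
def blobFn {K : Type} [Field K] (B : BlobData K P) (rl : Table P Bool) (a b c : P) : Timed K := do
  let o ← get B.best (a, b, c)
  match o with
  | some χ => pure χ
  | none => do
    let s ← get rl a
    let t ← get rl c
    if s || t then op (-5 / 14) else op (-1 / 2)

/-! ### Step 7: the lists `OneStep` -/

/-- All data that have been computed in Steps 1 to 6. -/
structure Data (K P : Type) where
  X : List P
  S : Array (Array P)
  roots : Array ℕ
  im : Table (P × P) Bool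
  pl : PlaceData P
  vert : VertexTable K P
  rl : Table P Bool
  blobs : BlobData K P

/-- Test whether there is a place `(R(p, _, _), c, C)` on the relator with number `k`. -/
def isPlaceAt {K : Type} (D : Data K P) (k p : ℕ) (c : P) (C : Colour) : Timed Bool := do
  let n ← op (D.roots.getD k 0)
  let q ← op (p % n)
  get D.pl.isPlace (k, q, c, C)

/-- A list `OneStep(𝐏)` under construction.  The place `𝐐` at distance `l` from `𝐏` on `R` with
extra letter `c` and colour `C` is determined by `(l, c, C)`; the value is the current `χ`. -/
abbrev StepTable (K P : Type) : Type := Table (ℕ × P × Colour) (Option K)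

/-- Include `(𝐐, l, χ)`, where `l < len = |R|` is required. -/
def includeStep {K : Type} [LinearOrder K] (len : ℕ) (T : StepTable K P) (l : ℕ) (c : P)
    (C : Colour) (χ : K) : Timed (StepTable K P) := do
  let small ← op (decide (l < len))
  if small then do
    let old ← get T (l, c, C)
    let better ← op (match old with
      | none => true
      | some χ' => decide (χ' < χ))
    if better then set T (l, c, C) (some χ) else pure T
  else pure T

/-- Let there be a red place with extra letter `c` at position `p` of the relator `R` with number
`k`.  For each place `𝐐 = (R(p + 1, b, d), x, C)` and each `y` that intermults with `b^σ`, include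
`(𝐐, l, χ₀ + χ₁ + χ₂)`, where `χ₁` bounds the curvature from the red blob between the two places
and `χ₂` bounds the curvature from the vertex at `𝐐`. -/
def redStep {K : Type} [Field K] [LinearOrder K] (D : Data K P) (k p : ℕ) (c : P) (χ₀ : K) (l : ℕ)
    (T : StepTable K P) : Timed (StepTable K P) := do
  let R ← wordAt D.S k
  let b ← letterAt R p
  let d ← letterAt R (p + 1)
  let b' ← sigma b
  let d' ← sigma d
  forEach D.X T fun T x => forEach colours T fun T C => do
    let q ← isPlaceAt D k (p + 1) x C
    if q then
      forEach D.X T fun T y => do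
        let t ← get D.im (y, b')
        if t then do
          let χ₁ ← blobFn D.blobs D.rl y b' c
          let χ₂ ← vertexFn D.vert (y, b', .red) (b, d, .green) (d', x, C)
          let χ ← op (χ₀ + χ₁ + χ₂)
          includeStep R.size T l x C χ
        else pure T
    else pure T

/-- The part of `ComputeOneStep(𝐏)` for a green place `𝐏` with location `ρ` and for one location
`ρ'` on a relator `R'` that instantiates it: run through the common consolidated edges of `R` and
`R'` of length `l = 1, 2, …`, starting at `ρ`, as long as the labels match. -/
def greenStep {K : Type} [Field K] [LinearOrder K] (D : Data K P) (ρ ρ' : Loc P)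
    (T : StepTable K P) : Timed (StepTable K P) := do
  let R ← wordAt D.S ρ.rel
  let R' ← wordAt D.S ρ'.rel
  let (T, _) ← forEach (List.range (R.size - 1)) (T, true) fun (T, alive) t => do
    if alive then do
      let d ← letterAt R (ρ.pos + t)
      let z ← letterAt R' (ρ'.pos + 2 * R'.size - 1 - t)
      let d' ← sigma d
      let fits ← op (decide (t < R'.size ∧ z = d'))
      if fits then do
        let l ← op (t + 1)
        let e ← letterAt R (ρ.pos + l)
        let y ← letterAt R' (ρ'.pos + 2 * R'.size - 1 - l)
        let e' ← sigma e
        let T ← forEach D.X T fun T x => forEach colours T fun T C => do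
          let q ← isPlaceAt D ρ.rel (ρ.pos + l) x C
          if q then do
            let χ ← vertexFn D.vert (y, d', .green) (d, e, .green) (e', x, C)
            match C with
            | .green => includeStep R.size T l x .green χ
            | .red => redStep D ρ.rel (ρ.pos + l) x χ (l + 1) T
          else pure T
        pure (T, true)
      else pure (T, false)
    else pure (T, false)
  pure T

/-- An item `(𝐐, l, χ)` of `OneStep(𝐏)`; `𝐐` is the place at distance `l` from `𝐏` with extra
letter `c` and colour `col`. -/
structure StepItem (K P : Type) where
  l : ℕ
  c : P
  col : Colour
  χ : K

/-- `ComputeOneStep(𝐏)`. -/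
def computeOneStep {K : Type} [Field K] [LinearOrder K] (D : Data K P) (p : Place P) :
    Timed (List (StepItem K P)) := do
  let R ← wordAt D.S p.loc.rel
  let T ← newTable (R.size * D.X.length * 2) none
  let T ← match p.col with
    | .red => redStep D p.loc.rel p.loc.pos p.c 0 1 T
    | .green => do
      let N ← get D.pl.inst (p.loc.rel, p.loc.pos, p.c)
      forEach N T fun T ρ' => greenStep D p.loc ρ' T
  forEach (List.range R.size) [] fun L l => forEach D.X L fun L c => forEach colours L fun L C => do
    let o ← get T (l, c, C)
    match o with
    | none => pure L
    | some χ => op (⟨l, c, C, χ⟩ :: L)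

/-- The lists `OneStep(𝐏)`, indexed by relator, position, letter and colour of `𝐏`. -/
abbrev OneStepTable (K P : Type) : Type := Table (ℕ × ℕ × P × Colour) (List (StepItem K P))

/-- Run `ComputeOneStep` at all places on the relators in `𝓡`, those with number less than `m`. -/
def allOneSteps {K : Type} [Field K] [LinearOrder K] (D : Data K P) (m r : ℕ) :
    Timed (OneStepTable K P) := do
  let O ← newTable (m * r * D.X.length * 2) []
  forEach D.pl.places O fun O p => do
    let inR ← op (decide (p.loc.rel < m))
    if inR then do
      let L ← computeOneStep D p
      set O (p.loc.rel, p.loc.pos, p.c, p.col) L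
    else pure O

/-! ### Step 8: the test at a place -/

/-- An entry `(𝐐, l, k, ψ)` of the list `L` made by `RSymVerifyAtPlace(𝐏_s, ε)`: the place `𝐐`
(relator `rel`, position `pos`, extra letter `c`, colour `col`) at distance `l` from `𝐏_s`, the
number `k` of steps, and `ψ`. -/
structure Entry (K P : Type) where
  rel : ℕ
  pos : ℕ
  c : P
  col : Colour
  l : ℕ
  k : ℕ
  ψ : K

/-- The list `L`, stored as a table: since `l` determines the location of `𝐐`, an entry
`(𝐐, l, k, ψ)` is the value `(k, ψ)` at the index `(l, c, C)`. -/
abbrev EntryTable (K P : Type) : Type := Table (ℕ × P × Colour) (Option (ℕ × K))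

/-- Write out the entries of `L`. -/
def readEntries {K : Type} (D : Data K P) (s : Place P) (len : ℕ) (L : EntryTable K P) :
    Timed (List (Entry K P)) := do
  let n ← op (D.roots.getD s.loc.rel 0)
  forEach (List.range (len + 1)) [] fun M l => forEach D.X M fun M c =>
    forEach colours M fun M C => do
      let o ← get L (l, c, C)
      match o with
      | none => pure M
      | some (k, ψ) => op (⟨s.loc.rel, (s.loc.pos + l) % n, c, C, l, k, ψ⟩ :: M)

/-- `RSymVerifyAtPlace(𝐏_s, ε)` with at most `ζ` steps: the result is `ok` (`true`), or an error
(`fail`) that carries the list `L`. -/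
def verifyAtPlace {K : Type} [Field K] [LinearOrder K] (D : Data K P) (O : OneStepTable K P)
    (ε : K) (ζ : ℕ) (s : Place P) : Timed (Except (List (Entry K P)) Unit) := do
  let R ← wordAt D.S s.loc.rel
  let n ← op (D.roots.getD s.loc.rel 0)
  let L ← newTable ((R.size + 1) * D.X.length * 2) none
  let L ← set L (0, s.c, s.col) (some (0, 0))
  let result ← forUntil (List.range ζ) L fun L i₀ =>
    forUntil (List.range (R.size + 1)) L fun L l =>
      forUntil D.X L fun L c =>
        forUntil colours L fun L C => do
          let i ← op (i₀ + 1)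
          let o ← get L (l, c, C)
          match o with
          | none => pure (.ok L)
          | some (k, ψ) => do
            let e ← op (decide (k = i - 1))
            if e then do
              let q ← op ((s.loc.pos + l) % n)
              let items ← get O (s.loc.rel, q, c, C)
              forUntil items L fun L it => do
                let l' ← op (l + it.l)
                let inside ← op (decide (l' ≤ R.size))
                if inside then do
                  let ψ' ← op (ψ + it.χ + (1 + ε) * it.l / R.size)
                  let full ← op (decide (l' = R.size))
                  let same ← op (decide (it.c = s.c ∧ it.col = s.col))
                  let neg ← op (decide (ψ' < 0))
                  let pos ← op (decide (0 < ψ'))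
                  if neg || (full && !same) then pure (.ok L)
                  else if pos && same && full then do
                    let M ← readEntries D s R.size L
                    pure (.error M)
                  else do
                    let old ← get L (l', it.c, it.col)
                    let better ← op (match old with
                      | none => true
                      | some (_, ψ'') => decide (ψ'' < ψ'))
                    if better then do
                      let L ← set L (l', it.c, it.col) (some (i, ψ'))
                      pure (.ok L)
                    else pure (.ok L)
                else pure (.ok L)
            else pure (.ok L)
  match result with
  | .error M => pure (.error M)
  | .ok _ => pure (.ok ())

/-- The procedure `RSymVerify(𝔓, ε)`.  It returns `ok` (`true`), or an error (`fail`) that carries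
a list `L`. -/
def RSymVerify {K : Type} [Field K] [LinearOrder K] [IsStrictOrderedRing K] [FloorRing K]
    (𝔓 : PregroupPresentation P) (ε : K) : Timed (Except (List (Entry K P)) Unit) := do
  let X := 𝔓.letters
  let A ← loadRelators 𝔓.relators
  let r ← longest A
  let S ← symmetrise A
  let im ← intermultTable X
  let (roots, locs) ← findLocations S
  let pl ← findPlaces X S r im locs
  let G ← vertexGraph X im locs pl.places
  let vert ← vertexTable X G
  let rl ← rLetters X S
  let blobs ← findBlobs X im rl
  let D : Data K P := ⟨X, S, roots, im, pl, vert, rl, blobs⟩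
  let O ← allOneSteps D A.size r
  let ζ ← op (min (⌈6 * (1 + ε)⌉₊ - 1) r)
  forUntil pl.places () fun _ s => do
    let inR ← op (decide (s.loc.rel < A.size))
    if inR then verifyAtPlace D O ε ζ s else pure (.ok ())

end Procedure

end RSym

/-!
The time bound is obtained by counting the turns of all loops.  A computation is described by a
Hoare triple with a time bound (`Within`), and there is one rule for each construct of the language;
the rule for loops, `forEach_within_index`, has an invariant that depends on the number of turns, so
that it can also bound the sizes of the lists a loop produces.  `WithinUntil` is the variant for
computations that may fail: the time spent on producing the error output is counted only once.

Let `n = |X|`, `m = |𝓡|`, and let `r` be the length of the longest relator.  There are at most `2m`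
words in `𝓡^±`, hence at most `2mr` locations and `4mrn` places, and at most `2mr` locations
instantiate a place.  The dominant costs are these.
* Dijkstra's algorithm takes `O(n³)` steps for each of the `2n²` sources (`dijkstra_within`), and
  `O(n⁵)` words of bounded length are enumerated for `𝓑` (`enumWords_within`).
* Comparing labels at all pairs of locations takes `O(m²r³)` steps (`findPlaces_within`).
* The list `OneStep` of a place takes `O(rn³)` steps for each location that instantiates it
  (`greenStep_within`), altogether `O(mrn · mr · rn³) = O(m²r³n⁴)`.
* The test at a place takes `O(ζ r²n²)` steps (`verifyAtPlace_within`), altogether `O(ζ m r³n³)`,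
  where `ζ ≤ 6(1 + ε)`.  This is the only place where `ε` enters.

The sum of all costs is a polynomial in `m`, `r`, `n`, linear in `ζ`, and each of its monomials is
at most `n⁵ + r³n⁴m²` (`monomial_le`).  If `r = 0`, this holds because there is at most one relator.
-/

namespace RSym

/-! ### Bounds on the time and the value of a computation -/

/-- A Hoare triple with a time bound: `x` takes at most `c` steps and its value satisfies `Q`. -/
def Within {α : Type} (x : Timed α) (c : ℕ) (Q : α → Prop) : Prop := x.time ≤ c ∧ Q x.val

section Rules

variable {α β σ ρ : Type}

theorem Within.mono {x : Timed α} {c c' : ℕ} {Q Q' : α → Prop} (h : Within x c Q) (hc : c ≤ c')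
    (hQ : ∀ a, Q a → Q' a) : Within x c' Q' := ⟨h.1.trans hc, hQ _ h.2⟩

theorem Within.le {x : Timed α} {c c' : ℕ} {Q : α → Prop} (h : Within x c Q) (hc : c ≤ c') :
    Within x c' Q := ⟨h.1.trans hc, h.2⟩

theorem Within.pure {a : α} {c : ℕ} {Q : α → Prop} (h : Q a) :
    Within (Pure.pure a : Timed α) c Q := ⟨Nat.zero_le _, h⟩

theorem Within.op {a : α} {c : ℕ} {Q : α → Prop} (h : Q a) : Within (op a) (c + 1) Q :=
  ⟨Nat.le_add_left _ _, h⟩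

theorem Within.bind {x : Timed α} {f : α → Timed β} {a b : ℕ} {Q : α → Prop} {Q' : β → Prop}
    (hx : Within x a Q) (hf : ∀ v, Q v → Within (f v) b Q') : Within (x >>= f) (a + b) Q' :=
  ⟨Nat.add_le_add hx.1 (hf _ hx.2).1, (hf _ hx.2).2⟩

theorem Within.bind_le {x : Timed α} {f : α → Timed β} {a b c : ℕ} {Q : α → Prop} {Q' : β → Prop}
    (hx : Within x a Q) (hc : a + b ≤ c) (hf : ∀ v, Q v → Within (f v) b Q') :
    Within (x >>= f) c Q' := (hx.bind hf).le hc

/-- The value of an elementary operation is substituted, so that facts about it remain visible.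
The budget `b + 1` lets numerals be counted down by unification. -/
theorem Within.op_bind {v : α} {f : α → Timed β} {b : ℕ} {Q' : β → Prop}
    (hf : Within (f v) b Q') : Within (RSym.op v >>= f) (b + 1) Q' :=
  ⟨by rw [add_comm]; exact Nat.add_le_add_left hf.1 _, hf.2⟩

/-- The value of the elementary operation is forgotten; used where it is a `match` expression that
is irrelevant for the time. -/
theorem Within.op_bind_any {v : α} {f : α → Timed β} {b : ℕ} {Q' : β → Prop}
    (hf : ∀ v, Within (f v) b Q') : Within (RSym.op v >>= f) (b + 1) Q' :=
  .op_bind (hf v)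

/-- The loop rule.  The invariant `I k` holds after `k` turns, which allows it to count the objects
that the loop produces. -/
theorem forEach_within_index (I : ℕ → σ → Prop) {body : σ → α → Timed σ} {c : ℕ} {l : List α}
    {s : σ} (h0 : I 0 s)
    (hb : ∀ k < l.length, ∀ s, ∀ x ∈ l, I k s → Within (body s x) c (I (k + 1))) :
    Within (forEach l s body) (l.length * (c + 1) + 1) (I l.length) := by
  induction l generalizing s I with
  | nil => exact ⟨by simp [forEach, op], h0⟩
  | cons x l ih =>
    have h1 := hb 0 (by simp) s x (by simp) h0
    have h2 := ih (fun k => I (k + 1)) h1.2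
      fun k hk s y hy => hb (k + 1) (by simpa using hk) s y (by simp [hy])
    refine ⟨?_, h2.2⟩
    have e : (forEach (x :: l) s body).time =
        1 + ((body s x).time + (forEach l (body s x).val body).time) := rfl
    rw [e, List.length_cons, Nat.succ_mul]
    have := h1.1
    have := h2.1
    omega

theorem forEach_within (I : σ → Prop) {body : σ → α → Timed σ} {c : ℕ} {l : List α} {s : σ}
    (h0 : I s) (hb : ∀ s, ∀ x ∈ l, I s → Within (body s x) c I) :
    Within (forEach l s body) (l.length * (c + 1) + 1) I :=
  forEach_within_index (fun _ => I) h0 fun _ _ => hb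

theorem forEach_range_within_index (I : ℕ → σ → Prop) {body : σ → ℕ → Timed σ} {c : ℕ} {n : ℕ}
    {s : σ} (h0 : I 0 s) (hb : ∀ k < n, ∀ s, ∀ x < n, I k s → Within (body s x) c (I (k + 1))) :
    Within (forEach (List.range n) s body) (n * (c + 1) + 1) (I n) := by
  have := forEach_within_index (l := List.range n) (body := body) (c := c) I h0
    (by simpa using hb)
  simpa using this

theorem forEach_range_within (I : σ → Prop) {body : σ → ℕ → Timed σ} {c : ℕ} {n : ℕ} {s : σ}
    (h0 : I s) (hb : ∀ s, ∀ x < n, I s → Within (body s x) c I) :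
    Within (forEach (List.range n) s body) (n * (c + 1) + 1) I :=
  forEach_range_within_index (fun _ => I) h0 fun _ _ => hb

theorem forEach_colours_within (I : σ → Prop) {body : σ → Colour → Timed σ} {c : ℕ} {s : σ}
    (h0 : I s) (hb : ∀ s C, I s → Within (body s C) c I) :
    Within (forEach colours s body) (2 * (c + 1) + 1) I :=
  forEach_within I h0 fun s C _ => hb s C

/-- A time bound for a computation that may stop with an error: a normal result takes at most `c`
steps and satisfies `I`, an error takes at most `c + e` steps.  The allowance `e` for the work done
on failure is kept apart because failure happens at most once, even inside nested loops. -/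
def WithinUntil (x : Timed (Except ρ σ)) (c e : ℕ) (I : σ → Prop) : Prop :=
  match x.val with
  | .ok s => x.time ≤ c ∧ I s
  | .error _ => x.time ≤ c + e

/-- The loop rule with errors: `c` is multiplied by the number of turns, and `e` is not. -/
theorem forUntil_within (I : σ → Prop) {body : σ → α → Timed (Except ρ σ)} {c e : ℕ}
    {l : List α} {s : σ} (h0 : I s)
    (hb : ∀ s, ∀ x ∈ l, I s → WithinUntil (body s x) c e I) :
    WithinUntil (forUntil l s body) (l.length * (c + 1) + 1) e I := by
  induction l generalizing s with
  | nil => exact ⟨by simp [forUntil, op], h0⟩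
  | cons x l ih =>
    have h1 := hb s x (by simp) h0
    have e1 : forUntil (x :: l) s body = (do
      let _ ← op ()
      let t ← body s x
      match t with
      | .error e => pure (.error e)
      | .ok t => forUntil l t body) := rfl
    rw [e1, List.length_cons, Nat.succ_mul]
    rcases hx : body s x with ⟨v | v, t⟩
    · simp only [WithinUntil, hx] at h1 ⊢
      change 1 + (t + 0) ≤ _
      omega
    · simp only [WithinUntil, hx] at h1
      have h2 := ih h1.2 fun s y hy => hb s y (by simp [hy])
      simp only [WithinUntil] at h2 ⊢
      change match (forUntil l v body).val with
        | .ok s => 1 + (t + (forUntil l v body).time) ≤ _ ∧ I s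
        | .error _ => 1 + (t + (forUntil l v body).time) ≤ _
      split <;> rename_i he <;> rw [he] at h2 <;> simp only at h2 ⊢
      · exact ⟨by omega, h2.2⟩
      · omega

theorem WithinUntil.le {x : Timed (Except ρ σ)} {c c' e : ℕ} {I : σ → Prop}
    (h : WithinUntil x c e I) (hc : c ≤ c') : WithinUntil x c' e I := by
  unfold WithinUntil at *
  split <;> rename_i he <;> rw [he] at h <;> simp only at h
  · exact ⟨h.1.trans hc, h.2⟩
  · omega

theorem WithinUntil.pure_ok {s : σ} {c e : ℕ} {I : σ → Prop} (h : I s) :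
    WithinUntil (Pure.pure (.ok s) : Timed (Except ρ σ)) c e I := ⟨Nat.zero_le _, h⟩

theorem WithinUntil.bind {x : Timed α} {f : α → Timed (Except ρ σ)} {a b e : ℕ} {Q : α → Prop}
    {I : σ → Prop} (hx : Within x a Q) (hf : ∀ v, Q v → WithinUntil (f v) b e I) :
    WithinUntil (x >>= f) (b + a) e I := by
  have h := hf _ hx.2
  have h1 := hx.1
  unfold WithinUntil at *
  change match (f x.val).val with
        | .ok s => x.time + (f x.val).time ≤ _ ∧ I s
        | .error _ => x.time + (f x.val).time ≤ _
  split <;> rename_i he <;> rw [he] at h <;> simp only at h ⊢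
  · exact ⟨by omega, h.2⟩
  · omega

theorem WithinUntil.op_bind {v : α} {f : α → Timed (Except ρ σ)} {b e : ℕ}
    {I : σ → Prop} (hf : WithinUntil (f v) b e I) :
    WithinUntil (RSym.op v >>= f) (b + 1) e I :=
  WithinUntil.bind (Q := (· = v)) (Within.op (c := 0) rfl) fun _ h => h ▸ hf

theorem WithinUntil.op_bind_any {v : α} {f : α → Timed (Except ρ σ)} {b e : ℕ}
    {I : σ → Prop} (hf : ∀ v, WithinUntil (f v) b e I) :
    WithinUntil (RSym.op v >>= f) (b + 1) e I :=
  .op_bind (hf v)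

theorem WithinUntil.bind_error {x : Timed ρ} {c e : ℕ} {Q : ρ → Prop} {I : σ → Prop}
    (hx : Within x e Q) :
    WithinUntil (x >>= fun M => Pure.pure (.error M) : Timed (Except ρ σ)) c e I :=
  hx.1.trans (Nat.le_add_left _ _)

theorem WithinUntil.time_le {x : Timed (Except ρ σ)} {c e : ℕ} {I : σ → Prop}
    (h : WithinUntil x c e I) : x.time ≤ c + e := by
  unfold WithinUntil at h
  split at h
  · omega
  · exact h

end Rules

/-- Postprocessing that passes errors on for free. -/
theorem WithinUntil.bind_until {ρ σ τ : Type} {x : Timed (Except ρ σ)}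
    {f : Except ρ σ → Timed (Except ρ τ)} {a b e : ℕ} {I : σ → Prop} {J : τ → Prop}
    (hx : WithinUntil x a e I) (herr : ∀ M, f (.error M) = pure (.error M))
    (hok : ∀ s, I s → WithinUntil (f (.ok s)) b e J) : WithinUntil (x >>= f) (b + a) e J := by
  rcases x with ⟨v | v, t⟩
  · simp only [WithinUntil] at hx
    have : (⟨.error v, t⟩ >>= f : Timed _) = ⟨.error v, t⟩ := by
      change (⟨(f _).val, t + (f _).time⟩ : Timed _) = _
      rw [herr]
      rfl
    rw [this]
    simp only [WithinUntil]
    omega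
  · simp only [WithinUntil] at hx
    exact WithinUntil.bind (x := ⟨Except.ok v, t⟩) (Q := (· = Except.ok v)) ⟨hx.1, rfl⟩
      fun _ h => h ▸ hok v hx.2

theorem Within.newTable {κ v : Type} (size : ℕ) (a : v) :
    Within (newTable size a : Timed (Table κ v)) size (· = fun _ => a) := ⟨le_rfl, rfl⟩

/-- A property of all cells of a table survives writing a cell. -/
theorem forall_update {κ v : Type} [DecidableEq κ] {T : Table κ v} {Q : v → Prop}
    (hT : ∀ k, Q (T k)) (k : κ) {a : v} (ha : Q a) (k' : κ) : Q (Function.update T k a k') := by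
  rcases eq_or_ne k' k with rfl | h
  · rwa [Function.update_self]
  · rw [Function.update_of_ne h]
    exact hT k'

/-! ### Words and relators -/

variable {P : Type}

theorem size_getD_le {S : Array (Array P)} {r : ℕ} (h : ∀ w ∈ S, w.size ≤ r) (k : ℕ) :
    (S.getD k #[]).size ≤ r := by
  rw [Array.getD_eq_getD_getElem?]
  rcases hk : S[k]? with _ | w
  · simp
  · simpa using h w (Array.mem_of_getElem? hk)

theorem wordAt_within {S : Array (Array P)} {r : ℕ} (h : ∀ w ∈ S, w.size ≤ r) (k : ℕ) :
    Within (wordAt S k) 1 fun w => w.size ≤ r := Within.op (c := 0) (size_getD_le h k)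

theorem eqWord_within [DecidableEq P] [Pregroup P] (u v : Array P) :
    Within (eqWord u v) (4 * u.size + 2) fun _ => True := by
  unfold eqWord
  refine .op_bind ?_
  split
  · refine (forEach_range_within (c := 3) _ trivial fun s x _ _ => ?_).le (by omega)
    exact .op_bind (.op_bind (.op trivial))
  · exact .pure trivial

theorem invWord_within [Pregroup P] (w : Array P) :
    Within (invWord w) (4 * w.size + 1) fun v => v.size = w.size := by
  unfold invWord
  refine (forEach_range_within_index (c := 3) (fun k (v : Array P) => v.size = k) rfl
    fun k _ s x _ h => ?_).le (by omega)
  exact .op_bind (.op_bind (.op (by simp [h])))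

theorem loadRelators_within {rels : List (List P)} {r : ℕ} (h : ∀ w ∈ rels, w.length ≤ r) :
    Within (loadRelators rels) (rels.length * (2 * r + 3) + 1) fun A =>
      A.size = rels.length ∧ ∀ w ∈ A, w.size ≤ r := by
  unfold loadRelators
  refine forEach_within_index (c := 2 * r + 2)
    (fun k (A : Array (Array P)) => A.size = k ∧ ∀ w ∈ A, w.size ≤ r) (by simp)
    fun k _ A w hw hA => ?_
  refine .bind_le (a := 2 * w.length + 1) (b := 1) (Q := fun v => v.size = w.length) ?_
    (by have := h w hw; omega) fun v hv => .op ?_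
  · refine (forEach_within_index (c := 1) (fun k (v : Array P) => v.size = k) rfl
      fun k _ s x _ h => .op ?_).le (by omega)
    simp [h]
  · refine ⟨by simp [hA.1], fun u hu => ?_⟩
    rcases Array.mem_push.1 hu with hu | rfl
    · exact hA.2 u hu
    · exact hv ▸ h w hw

theorem longest_within {S : Array (Array P)} {r : ℕ} (h : ∀ w ∈ S, w.size ≤ r) :
    Within (longest S) (3 * S.size + 1) fun x => x ≤ r := by
  unfold longest
  refine (forEach_range_within (c := 2) (fun x => x ≤ r) (Nat.zero_le r)
    fun s k _ hs => ?_).le (by omega)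
  exact .op_bind (.op (max_le hs (size_getD_le h k)))

theorem symmetrise_within [DecidableEq P] [Pregroup P] {A : Array (Array P)} {r : ℕ}
    (h : ∀ w ∈ A, w.size ≤ r) :
    Within (symmetrise A) (A.size * (4 * r + 5 + 2 * A.size * (4 * r + 5)) + 1) fun S =>
      S.size ≤ 2 * A.size ∧ ∀ w ∈ S, w.size ≤ r := by
  unfold symmetrise
  refine (forEach_range_within_index (c := 4 * r + 4 + 2 * A.size * (4 * r + 5))
    (fun k (S : Array (Array P)) => S.size ≤ A.size + k ∧ ∀ w ∈ S, w.size ≤ r) ⟨le_rfl, h⟩ ?_).mono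
      (by apply le_of_eq; ring) fun S hS => ⟨by omega, hS.2⟩
  intro k hk S j hj hS
  refine .bind_le (wordAt_within hS.2 j) (b := 4 * r + 3 + 2 * A.size * (4 * r + 5)) (by omega)
    fun w hw => ?_
  refine .bind_le (invWord_within w) (b := 2 + 2 * A.size * (4 * r + 5)) (by omega)
    fun v hv => ?_
  refine .bind_le (a := 1 + 2 * A.size * (4 * r + 5)) (b := 1) (Q := fun _ => True) ?_ (by omega)
    fun f _ => ?_
  · refine (forEach_range_within (c := 4 * r + 4) _ trivial fun f j hj _ => ?_).le ?_
    · refine .bind_le (wordAt_within hS.2 j) (b := 4 * r + 3) (by omega) fun u hu => ?_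
      exact .bind_le (eqWord_within u v) (b := 1) (by omega) fun _ _ => .op trivial
    · have : S.size ≤ 2 * A.size := by omega
      nlinarith
  · split
    · exact .pure ⟨by omega, hS.2⟩
    · refine .op ⟨by simp; omega, fun u hu => ?_⟩
      rcases Array.mem_push.1 hu with hu | rfl
      · exact hS.2 u hu
      · omega

/-! ### Intermult pairs and locations -/

theorem intermultTable_within [DecidableEq P] [Pregroup P] (X : List P) :
    Within (intermultTable X)
      (X.length * X.length + (X.length * (X.length * (5 * X.length + 6) + 2) + 1))
      fun _ => True := by
  unfold intermultTable
  refine .bind (a := X.length * X.length) (Q := fun _ => True) ⟨le_rfl, trivial⟩ fun T _ => ?_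
  refine forEach_within _ trivial fun T a _ _ => ?_
  refine forEach_within _ trivial fun T b _ _ => ?_
  refine .op_bind (.op_bind ?_)
  split
  · exact .pure trivial
  refine .op_bind ?_
  split
  · exact .op trivial
  refine .bind_le (a := 5 * X.length + 1) (b := 1) (Q := fun _ => True) ?_ (by omega) fun f _ => ?_
  · refine (forEach_within (c := 4) _ trivial fun f x _ _ => ?_).le (by omega)
    exact .op_bind (.op_bind (.op_bind (.op trivial)))
  · split
    · exact .op trivial
    · exact .pure trivial

theorem rootLength_within [DecidableEq P] [Pregroup P] (R : Array P) :
    Within (rootLength R) (R.size * (4 * R.size + 5) + 1) fun l => l ≤ R.size := by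
  unfold rootLength
  refine .bind_le (b := 0) (Q := fun o => ∀ l ∈ o, l ≤ R.size)
    (forEach_range_within (c := 4 * R.size + 4) _ (by simp) fun best l₀ hl h => ?_) le_rfl
    fun o ho => ?_
  · rcases best with _ | l
    · refine .op_bind (.op_bind ?_)
      split
      · refine .bind_le (a := 4 * R.size + 1) (b := 1) (Q := fun _ => True) ?_ (by omega)
          fun ok _ => ?_
        · refine (forEach_range_within (c := 3) _ trivial fun f x _ _ => ?_).le (by omega)
          exact .op_bind (.op_bind (.op trivial))
        · split
          · exact .op (by simp; omega)
          · exact .pure (by simp)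
      · exact .pure (by simp)
    · exact .pure h
  · rcases o with _ | l
    · exact .pure (Nat.zero_le _)
    · exact .pure (ho l rfl)

theorem findLocations_within [DecidableEq P] [Pregroup P] {S : Array (Array P)} {r : ℕ}
    (h : ∀ w ∈ S, w.size ≤ r) :
    Within (findLocations S) (S.size * (r * (4 * r + 5) + 4 * r + 5) + 1) fun D =>
      D.2.length ≤ S.size * r := by
  unfold findLocations
  refine forEach_range_within_index (c := r * (4 * r + 5) + 4 * r + 4)
    (fun k (D : Array ℕ × List (Loc P)) => D.2.length ≤ k * r) (by simp) ?_
  rintro k - ⟨roots, locs⟩ j - hD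
  refine .bind_le (wordAt_within h j) (b := r * (4 * r + 5) + 4 * r + 3) (by omega) fun R hR => ?_
  refine .bind_le (a := r * (4 * r + 5) + 1) (b := 4 * r + 2) (Q := fun l => l ≤ r)
    ((rootLength_within R).mono (by gcongr) fun l hl => hl.trans hR) (by omega) fun l hl => ?_
  refine .op_bind ?_
  refine .bind_le (b := 0) (a := 4 * l + 1) (Q := fun L => L.length ≤ (k + 1) * r) ?_ (by omega)
    fun L hL => .pure hL
  refine (forEach_range_within_index (c := 3) (fun i L => L.length ≤ locs.length + i) (by simp)
    fun i _ L p _ hL => ?_).mono (by omega) fun L hL => ?_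
  · exact .op_bind (.op_bind (.op (by simp; omega)))
  · simp only at hD
    rw [Nat.succ_mul]
    omega

theorem mutuallyInverse_within [DecidableEq P] [Pregroup P] {S : Array (Array P)} {r : ℕ}
    (h : ∀ w ∈ S, w.size ≤ r) (ρ ρ' : Loc P) :
    Within (mutuallyInverse S ρ ρ') (5 * r + 4) fun _ => True := by
  unfold mutuallyInverse
  refine .bind_le (wordAt_within h _) (b := 5 * r + 3) (by omega) fun R hR => ?_
  refine .bind_le (wordAt_within h _) (b := 5 * r + 2) (by omega) fun R' hR' => ?_
  refine .op_bind ?_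
  split
  · refine (forEach_range_within (c := 4) _ trivial fun f x _ _ => ?_).le (by omega)
    exact .op_bind (.op_bind (.op_bind (.op trivial)))
  · exact .pure trivial

/-! ### Places and the vertex graph -/

/-- There are at most `p` places, and at most `i` locations instantiate each green place. -/
def PlaceData.Bounded (D : PlaceData P) (p i : ℕ) : Prop :=
  D.places.length ≤ p ∧ ∀ key, (D.inst key).length ≤ i

/-- Each location gives at most one red and one green place for each letter. -/
theorem findPlaces_within [DecidableEq P] [Pregroup P] (X : List P) {S : Array (Array P)} {r : ℕ}
    (h : ∀ w ∈ S, w.size ≤ r) (r' : ℕ) (im : Table (P × P) Bool) (locs : List (Loc P)) :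
    Within (findPlaces X S r' im locs)
      (S.size * r' * X.length * 2 + (S.size * r' * X.length +
        (locs.length * (locs.length * (5 * r + 7) + X.length * (3 * locs.length + 9) + 4) + 1)))
      fun D => D.Bounded (locs.length * (2 * X.length)) locs.length := by
  unfold findPlaces
  refine .bind (.newTable _ _) fun T hT => .bind (.newTable _ _) fun T' hT' => ?_
  -- Each turn of the outer loop adds at most `2|X|` places, and each turn of the inner loop two.
  refine forEach_within_index
    (c := locs.length * (5 * r + 7) + X.length * (3 * locs.length + 9) + 3)
    (fun k (D : PlaceData P) => D.Bounded (k * (2 * X.length)) locs.length)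
    ⟨by simp, by simp [hT']⟩ fun k _ D ρ _ hD => ?_
  refine .op_bind ?_
  refine .bind_le (a := locs.length * (5 * r + 7) + 1)
    (b := X.length * (3 * locs.length + 9) + 1) (Q := fun N => N.length ≤ locs.length) ?_
    (by omega) fun N hN => ?_
  · refine forEach_within_index (c := 5 * r + 6) (fun j (N : List (Loc P)) => N.length ≤ j)
      (by simp) fun j _ N ρ' _ hN => ?_
    refine .op_bind ?_
    split
    · refine .bind_le (mutuallyInverse_within h ρ ρ') (b := 1) (by omega) fun m _ => ?_
      split
      · exact .pure (by omega)
      · exact .op (by simpa using hN)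
    · exact .pure (by omega)
  refine (forEach_within_index (c := 3 * locs.length + 8)
    (fun j (D : PlaceData P) => D.Bounded (k * (2 * X.length) + 2 * j) locs.length)
    hD fun j _ D c _ hD => ?_).mono le_rfl fun D hD => ⟨?_, hD.2⟩
  · refine .op_bind ?_
    -- The code after the conditional is a join point; unfolding copies it into both branches.
    dsimp only
    split
    on_goal 1 => refine .op_bind (.op_bind ?_)
    all_goals
      refine .bind_le (a := 0) (b := 3 * locs.length + 5)
        (Q := fun D => D.Bounded (k * (2 * X.length) + 2 * j + 1) locs.length)
        (.pure ?_) (by omega) fun D hD => ?_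
    on_goal 1 => exact ⟨by simpa using hD.1, hD.2⟩
    on_goal 2 => exact ⟨by have := hD.1; omega, hD.2⟩
    all_goals
      refine .bind_le (a := 3 * locs.length + 1) (b := 4) (Q := fun N => N.length ≤ locs.length)
        ?_ (by omega) fun N hN => .op_bind ?_
      · refine (forEach_within_index (c := 2) (fun j (N : List (Loc P)) => N.length ≤ j)
          (by simp) fun j _ N ρ' _ hN => ?_).mono (by omega) fun N (h : N.length ≤ _) => h.trans hN
        refine .op_bind ?_
        split
        · exact .op (by simpa using hN)
        · exact .pure (by omega)
      split
      · exact .pure ⟨by have := hD.1; omega, hD.2⟩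
      · refine .op_bind (.op_bind (.op_bind (.pure
          ⟨?_, forall_update (Q := fun N : List (Loc P) => N.length ≤ locs.length) hD.2 _ hN⟩)))
        have := hD.1
        simp only [List.length_cons]
        omega
  · have := hD.1
    rw [Nat.succ_mul]
    omega

theorem vertexGraph_within [DecidableEq P] [Pregroup P] (X : List P) (im : Table (P × P) Bool)
    (locs : List (Loc P)) (places : List (Place P)) :
    Within (vertexGraph X im locs places)
      (X.length ^ 2 * 2 + (X.length ^ 2 + ((locs.length * 4 + 1) +
        ((X.length * (X.length * 3 + 2) + 1) + (X.length ^ 3 * 4 + ((places.length * 3 + 1) +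
        (X.length * (X.length * (X.length * 7 + 3) + 2) + 1)))))))
      fun _ => True := by
  unfold vertexGraph
  refine .bind (.newTable _ _) fun V _ => .bind (.newTable _ _) fun A _ => ?_
  refine .bind (Q := fun _ => True) (forEach_within (c := 3) _ trivial ?_) ?_
  · rintro ⟨V, A⟩ ρ - -
    exact .op_bind (.op_bind (.op_bind (.pure trivial)))
  rintro ⟨V, A⟩ -
  refine .bind (Q := fun _ => True) (forEach_within _ trivial fun V a _ _ =>
    forEach_within (c := 2) _ trivial fun V b _ _ => .op_bind ?_) fun V _ => ?_
  · split
    · exact .op trivial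
    · exact .pure trivial
  refine .bind (.newTable _ _) fun E _ => ?_
  refine .bind (Q := fun _ => True) (forEach_within (c := 2) _ trivial fun E p _ _ =>
    .op_bind ?_) fun E _ => ?_
  · split
    · exact .op trivial
    · exact .pure trivial
  refine .bind (b := 0) (Q := fun _ => True) (forEach_within _ trivial fun E a _ _ =>
    forEach_within (c := X.length * 7 + 2) _ trivial fun E b _ _ =>
    .op_bind (forEach_within (c := 6) _ trivial fun E c _ _ => ?_)) fun E _ => .pure trivial
  refine .op_bind (.op_bind ?_)
  dsimp only
  split
  all_goals
    refine .bind_le (a := 1) (b := 3) (Q := fun _ => True) ?_ le_rfl fun E _ =>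
      .op_bind (.op_bind ?_)
  · exact .op trivial
  · split
    · exact .op trivial
    · exact .pure trivial
  · exact .pure trivial
  · split
    · exact .op trivial
    · exact .pure trivial

/-! ### Path weights and the function `Vertex` -/

theorem relax_within [DecidableEq P] [Pregroup P] (X : List P)
    (E : Table (GVertex P × P × Colour) Bool) (u : GVertex P) (st : DijkstraState P) :
    Within (relax X E u st) (14 * X.length + 4) fun _ => True := by
  unfold relax
  refine .op_bind (.op_bind (.op_bind ?_))
  refine (forEach_within (c := 13) (fun _ => True) trivial fun st c _ _ =>
    forEach_colours_within (c := 5) (fun _ => True) trivial fun st C _ => .op_bind ?_).le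
      (by omega)
  split
  · refine .op_bind (.op_bind_any fun better => ?_)
    split
    · refine .op_bind ?_
      split
      · exact .op_bind (.pure trivial)
      · exact .op_bind (.pure trivial)
    · exact .pure trivial
  · exact .pure trivial

/-- Every turn of the main loop costs at most one call of `relax`, that is `O(|X|)` steps, and there
are `O(|X|²)` turns; so the bound `O(|X|³)` does not depend on how the queue evolves. -/
theorem dijkstra_within [DecidableEq P] [Pregroup P] (X : List P)
    (E : Table (GVertex P × P × Colour) Bool) (s : GVertex P) :
    Within (dijkstra X E s) (X.length ^ 2 * 2 + (X.length ^ 2 * 2 + ((14 * X.length + 4) +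
      ((4 * (2 * X.length ^ 2) + 1) * (14 * X.length + 7) + 1)))) fun _ => True := by
  unfold dijkstra
  refine .bind (.newTable _ _) fun dist _ => .bind (.newTable _ _) fun fin _ => ?_
  refine .bind (relax_within X E s _) fun st _ => ?_
  refine .bind (b := 0) (Q := fun _ => True) (forEach_range_within (c := 14 * X.length + 6)
    (fun _ => True) trivial fun st _ _ _ => ?_) fun st _ => .pure trivial
  split
  · refine .op_bind ?_
    split
    · exact .op trivial
    · exact .op_bind (relax_within X E _ _)
  · split
    · exact .pure trivial
    · exact .op trivial

theorem pathWeights_within [DecidableEq P] [Pregroup P] (X : List P) (G : VertexGraph P) :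
    Within (pathWeights X G) (X.length ^ 2 * 2 + (X.length * (X.length *
      (2 * (X.length ^ 2 * 2 + (X.length ^ 2 * 2 + ((14 * X.length + 4) +
      ((4 * (2 * X.length ^ 2) + 1) * (14 * X.length + 7) + 1))) + 3) + 2) + 2) + 1))
      fun _ => True := by
  unfold pathWeights
  refine .bind (.newTable _ _) fun W _ => ?_
  refine forEach_within _ trivial fun W a _ _ => forEach_within _ trivial fun W b _ _ =>
    forEach_colours_within _ trivial fun W C _ => .op_bind ?_
  split
  · exact .bind_le (b := 1) (dijkstra_within X _ _) (by omega) fun _ _ => .op trivial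
  · exact .pure trivial

theorem vertexTable_within {K : Type} [Field K] [DecidableEq P] [Pregroup P] (X : List P)
    (G : VertexGraph P) :
    Within (vertexTable (K := K) X G) ((X.length ^ 2 * 2 + (X.length * (X.length *
      (2 * (X.length ^ 2 * 2 + (X.length ^ 2 * 2 + ((14 * X.length + 4) +
      ((4 * (2 * X.length ^ 2) + 1) * (14 * X.length + 7) + 1))) + 3) + 2) + 2) + 1)) +
      (X.length ^ 4 * 4 + (X.length * (X.length * (X.length * (2 * (X.length * 14 + 3) + 2)
        + 5) + 2) + 1))) fun _ => True := by
  unfold vertexTable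
  refine .bind (pathWeights_within X G) fun W _ => .bind (.newTable _ _) fun T _ => ?_
  refine forEach_within _ trivial fun T a _ _ => forEach_within _ trivial fun T b _ _ =>
    .op_bind ?_
  split
  · refine .op_bind (.op_bind (forEach_within _ trivial fun T y _ _ =>
      forEach_colours_within _ trivial fun T C₁ _ => .op_bind ?_))
    split
    · refine forEach_within (c := 13) _ trivial fun T c _ _ =>
        forEach_colours_within (c := 5) _ trivial fun T C₂ _ => .op_bind ?_
      split
      · exact .op_bind (.op_bind (.op_bind (.op trivial)))
      · exact .pure trivial
    · exact .pure trivial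
  · exact .pure trivial

/-! ### The function `Blob` -/

theorem rLetters_within [DecidableEq P] [Pregroup P] (X : List P) {S : Array (Array P)} {r : ℕ}
    (h : ∀ w ∈ S, w.size ≤ r) :
    Within (rLetters X S) (X.length + (S.size * (3 * r + 3) + 1)) fun _ => True := by
  unfold rLetters
  refine .bind (.newTable _ _) fun T _ => forEach_range_within (c := 3 * r + 2) _ trivial
    fun T k _ _ => .bind_le (wordAt_within h k) (b := 3 * r + 1) (by omega) fun w hw => ?_
  refine (forEach_range_within (c := 2) _ trivial fun T p _ _ => ?_).le (by omega)
  exact .op_bind (.op trivial)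

/-- Every recursive call removes a letter from the stack. -/
theorem pushLetter_within [DecidableEq P] [Pregroup P] (x : P) (s : List P) :
    Within (pushLetter x s) (2 * s.length + 2) fun t => t.length ≤ s.length + 1 := by
  induction s generalizing x with
  | nil => exact .op (by simp)
  | cons y s ih =>
    unfold pushLetter
    refine .op_bind ?_
    split
    · exact .op (by simp)
    · refine .op_bind ?_
      split
      · exact .pure (by simp; omega)
      · exact (ih _).mono (by simp; omega) fun t ht => by simp; omega

/-- The stack holds at most as many letters as have been read, so that pushing one of at most six
letters costs at most `14` steps. -/
theorem reduceWord_within [DecidableEq P] [Pregroup P] {w : List P} (hw : w.length ≤ 6) :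
    Within (reduceWord w) 91 fun _ => True := by
  unfold reduceWord
  refine (forEach_within_index (c := 14) (fun k (s : List P) => s.length ≤ k) (by simp)
    fun k hk s x _ hs => ?_).mono (by omega) fun _ _ => trivial
  exact (pushLetter_within x s).mono (by omega) fun t ht => by omega

theorem hasTrivialSubword_within [DecidableEq P] [Pregroup P] {w : List P} (hw : w.length ≤ 6) :
    Within (hasTrivialSubword w) 2833 fun _ => True := by
  unfold hasTrivialSubword
  refine (forEach_range_within (c := 471) _ trivial fun f i _ _ =>
    (forEach_range_within (c := 93) _ trivial fun f m _ _ => ?_).le (by omega)).le (by omega)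
  refine .op_bind (.bind_le (reduceWord_within ?_) (b := 1) (by omega) fun _ _ => .op trivial)
  simp
  omega

theorem tryWord_within {K : Type} [Field K] [LinearOrder K] [DecidableEq P] [Pregroup P]
    (im : Table (P × P) Bool) (rl : Table P Bool) (B : BlobData K P) {w : List P}
    (hw : w.length ≤ 6) : Within (tryWord im rl B w) 3100 fun _ => True := by
  unfold tryWord
  refine .op_bind ?_
  refine .bind_le (a := 31) (b := 3068) (Q := fun _ => True) ?_ (by omega) fun ok _ => ?_
  · refine (forEach_range_within (c := 4) _ trivial fun _ _ _ _ => ?_).le (by omega)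
    exact .op_bind (.op_bind (.op_bind (.op trivial)))
  refine .bind_le (a := 19) (b := 3049) (Q := fun _ => True) ?_ (by omega) fun bad _ => ?_
  · refine (forEach_within (c := 2) _ trivial fun _ _ _ _ => ?_).le (by omega)
    exact .op_bind (.op trivial)
  refine .op_bind ?_
  split
  · refine .bind_le (b := 2957) (reduceWord_within hw) (by omega) fun s _ => ?_
    refine .bind_le (b := 124) (hasTrivialSubword_within hw) (by omega) fun sub _ => ?_
    split
    · refine .op_bind (.op_bind ?_)
      refine .bind_le (a := 43) (b := 0) (Q := fun _ => True) ?_ (by omega)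
        fun best _ => .pure trivial
      refine (forEach_range_within (c := 6) _ trivial fun _ _ _ _ => ?_).le (by omega)
      exact .op_bind (.op_bind (.op_bind (.op_bind (.op_bind (.op trivial)))))
    · exact .pure trivial
  · exact .pure trivial

theorem treatWord_within {K : Type} [Field K] [LinearOrder K] [DecidableEq P] [Pregroup P]
    (im : Table (P × P) Bool) (rl : Table P Bool) (B : BlobData K P) {w : List P}
    (hw : w.length ≤ 5) : Within (treatWord im rl B w) 6300 fun _ => True := by
  unfold treatWord
  refine .op_bind ?_
  split
  · refine .bind_le (b := 3194) (tryWord_within im rl B (by omega)) (by omega) fun B _ => ?_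
    refine .op_bind ?_
    split
    · refine .bind_le (b := 3102) (reduceWord_within (by omega)) (by omega) fun s _ => ?_
      split
      · exact .op_bind (.op_bind (tryWord_within im rl B (by simp; omega)))
      · exact .pure trivial
    · exact .pure trivial
  · exact .pure trivial

/-- Only words of length at most six are treated, each in bounded time, so that the time is
proportional to the number of words enumerated.  The hypothesis `X ≠ []` is needed because a loop
over the empty list still costs a step. -/
theorem enumWords_within {K : Type} [Field K] [LinearOrder K] [DecidableEq P] [Pregroup P]
    {X : List P} (hX : X ≠ []) (im : Table (P × P) Bool) (rl : Table P Bool) (k : ℕ) {w : List P}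
    (hw : w.length + k ≤ 5) (B : BlobData K P) :
    Within (enumWords X im rl k w B) (6304 * k * X.length ^ k) fun _ => True := by
  induction k generalizing w B with
  | zero => exact .pure trivial
  | succ k ih =>
    unfold enumWords
    refine (forEach_within (c := 6302 + 6304 * k * X.length ^ k) (fun _ => True) trivial
      fun B x _ _ => ?_).le ?_
    · dsimp only
      split
      all_goals
        refine .bind_le (a := 1) (b := 6301 + 6304 * k * X.length ^ k) (Q := fun _ => True) ?_
          (by omega) fun ok _ => ?_
      on_goal 1 => exact .pure trivial
      on_goal 2 => exact .op trivial
      all_goals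
        split
        · refine .le (c := 6300 + 6304 * k * X.length ^ k + 1) (.op_bind ?_) (by omega)
          refine .bind (treatWord_within im rl B ?_) fun B _ => ih ?_ B
          · simp
            omega
          · simp
            omega
        · exact .pure trivial
    · have h1 : 1 ≤ X.length := List.length_pos_iff.2 hX
      have h2 : X.length ≤ X.length ^ (k + 1) := Nat.le_self_pow (by omega) _
      have h3 : X.length * (6302 + 6304 * k * X.length ^ k + 1) + 1 =
        6303 * X.length + 1 + 6304 * k * X.length ^ (k + 1) := by ring
      have h4 : 6304 * (k + 1) * X.length ^ (k + 1) =
        6304 * X.length ^ (k + 1) + 6304 * k * X.length ^ (k + 1) := by ring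
      omega

theorem findBlobs_within {K : Type} [Field K] [LinearOrder K] [DecidableEq P] [Pregroup P]
    {X : List P} (hX : X ≠ []) (im : Table (P × P) Bool) (rl : Table P Bool) :
    Within (findBlobs (K := K) X im rl) (X.length ^ 3 + 6304 * 5 * X.length ^ 5)
      fun _ => True := by
  unfold findBlobs
  exact .bind (.newTable _ _) fun _ _ => enumWords_within hX im rl 5 (by simp) _

/-! ### The lists `OneStep` -/

variable {K : Type}

theorem isPlaceAt_within (D : Data K P) (k p : ℕ) (c : P) (C : Colour) :
    Within (isPlaceAt D k p c C) 3 fun _ => True :=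
  .op_bind (.op_bind (.op trivial))

theorem includeStep_within [LinearOrder K] [DecidableEq P] (len : ℕ) (T : StepTable K P) (l : ℕ)
    (c : P) (C : Colour) (χ : K) : Within (includeStep len T l c C χ) 4 fun _ => True := by
  unfold includeStep
  refine .op_bind ?_
  split
  · refine .op_bind (.op_bind_any fun better => ?_)
    split
    · exact .op trivial
    · exact .pure trivial
  · exact .pure trivial

theorem blobFn_within [Field K] (B : BlobData K P) (rl : Table P Bool) (a b c : P) :
    Within (blobFn B rl a b c) 4 fun _ => True := by
  unfold blobFn
  refine .op_bind ?_
  split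
  · exact .pure trivial
  · refine .op_bind (.op_bind ?_)
    split
    · exact .op trivial
    · exact .op trivial

theorem redStep_within [Field K] [LinearOrder K] [DecidableEq P] [Pregroup P] (D : Data K P)
    (k p : ℕ) (c : P) (χ₀ : K) (l : ℕ) (T : StepTable K P) :
    Within (redStep D k p c χ₀ l T) (D.X.length * (24 * D.X.length + 12) + 6) fun _ => True := by
  unfold redStep
  refine .op_bind (.op_bind (.op_bind (.op_bind (.op_bind ?_))))
  refine forEach_within (c := 24 * D.X.length + 11) (fun _ => True) trivial fun T x _ _ => ?_
  refine (forEach_colours_within (c := 12 * D.X.length + 4) (fun _ => True) trivial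
    fun T C _ => ?_).le (by omega)
  refine .bind_le (isPlaceAt_within _ _ _ _ _) (b := 12 * D.X.length + 1) (by omega) fun q _ => ?_
  split
  · refine (forEach_within (c := 11) (fun _ => True) trivial fun T y _ _ => .op_bind ?_).le
      (by omega)
    split
    · refine .bind_le (blobFn_within _ _ _ _ _) (b := 6) (by omega) fun χ₁ _ => ?_
      exact .op_bind (.op_bind (includeStep_within _ _ _ _ _ _))
    · exact .pure trivial
  · exact .pure trivial

/-- At each of the at most `r` lengths of the common edge, the dominant cost is one `redStep` for
each letter, hence `O(r |X|³)` in total. -/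
theorem greenStep_within [Field K] [LinearOrder K] [DecidableEq P] [Pregroup P] {D : Data K P}
    {r : ℕ} (h : ∀ w ∈ D.S, w.size ≤ r) (ρ ρ' : Loc P) (T : StepTable K P) :
    Within (greenStep D ρ ρ' T)
      (r * (D.X.length * (2 * (D.X.length * (24 * D.X.length + 12) + 6) + 12) + 10) + 3)
      fun _ => True := by
  unfold greenStep
  refine .bind_le (wordAt_within h ρ.rel) (b := r * (D.X.length * (2 * (D.X.length *
    (24 * D.X.length + 12) + 6) + 12) + 10) + 2) (by omega) fun R hR => .op_bind ?_
  have hR' : R.size - 1 ≤ r := by omega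
  refine .bind_le (b := 0) (Q := fun _ => True) (forEach_range_within
    (c := D.X.length * (2 * (D.X.length * (24 * D.X.length + 12) + 6) + 12) + 9)
    (fun _ => True) trivial ?_) (Nat.add_le_add_right (Nat.mul_le_mul_right _ hR') 1)
    fun _ _ => .pure trivial
  rintro ⟨T, alive⟩ t - -
  dsimp only
  split
  · refine .op_bind (.op_bind (.op_bind (.op_bind_any fun fits => ?_)))
    split
    · refine .op_bind (.op_bind (.op_bind (.op_bind ?_)))
      refine .bind (b := 0) (Q := fun _ => True) (forEach_within
        (c := 2 * (D.X.length * (24 * D.X.length + 12) + 6) + 11) (fun _ => True) trivial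
        fun T x _ _ => (forEach_colours_within
          (c := D.X.length * (24 * D.X.length + 12) + 6 + 4) (fun _ => True) trivial
          fun T C _ => ?_).le (by omega)) fun _ _ => .pure trivial
      refine .bind_le (isPlaceAt_within _ _ _ _ _)
        (b := D.X.length * (24 * D.X.length + 12) + 6 + 1) (by omega) fun q _ => ?_
      split
      · refine .op_bind ?_
        split
        · exact (includeStep_within _ _ _ _ _ _).le (by omega)
        · exact redStep_within _ _ _ _ _ _ _
      · exact .pure trivial
    · exact .pure trivial
  · exact .pure trivial

/-- A bound on the time of `computeOneStep` with relators of length at most `r`, `n` letters, and at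
most `i` locations instantiating a place. -/
def computeOneStepTime (r n i : ℕ) : ℕ :=
  r * n * 2 + (n * (24 * n + 12) + 6 +
    (i * (r * (n * (2 * (n * (24 * n + 12) + 6) + 12) + 10) + 4) + 2)) +
    (r * (n * 8 + 2) + 1) + 1

/-- The resulting list has one item at most for each distance, letter and colour. -/
theorem computeOneStep_within [Field K] [LinearOrder K] [DecidableEq P] [Pregroup P]
    {D : Data K P} {r i : ℕ} (h : ∀ w ∈ D.S, w.size ≤ r)
    (hi : ∀ key, (D.pl.inst key).length ≤ i) (p : Place P) :
    Within (computeOneStep D p) (computeOneStepTime r D.X.length i)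
      fun L => L.length ≤ r * (2 * D.X.length) := by
  unfold computeOneStep computeOneStepTime
  -- The costs of `greenStep` and `redStep` are made atoms for linear arithmetic.
  generalize hg : r * (D.X.length * (2 * (D.X.length * (24 * D.X.length + 12) + 6) + 12) + 10) = g
  generalize hd : D.X.length * (24 * D.X.length + 12) = d
  refine .bind_le (wordAt_within h _) (b := r * D.X.length * 2 + (d + 6 + (i * (g + 4) + 2)) +
    (r * (D.X.length * 8 + 2) + 1)) (by omega) fun R hR => ?_
  have hR' : R.size * D.X.length * 2 ≤ r * D.X.length * 2 := by gcongr
  refine .bind_le (.newTable _ _) (b := (d + 6 + (i * (g + 4) + 2)) +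
    (r * (D.X.length * 8 + 2) + 1)) (by omega) fun T _ => ?_
  have fin : ∀ T : StepTable K P, Within
      (forEach (List.range R.size) [] fun L l => forEach D.X L fun L c => forEach colours L
        fun L C => do
          let o ← get T (l, c, C)
          match o with
          | none => pure L
          | some χ => op (⟨l, c, C, χ⟩ :: L)) (r * (D.X.length * 8 + 2) + 1)
      fun L : List (StepItem K P) => L.length ≤ r * (2 * D.X.length) := by
    intro T
    refine (forEach_range_within_index (c := D.X.length * 8 + 1)
      (fun k (L : List (StepItem K P)) => L.length ≤ k * (2 * D.X.length)) (by simp)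
      fun k _ L l _ hL => ?_).mono (by gcongr) fun L hL => hL.trans (by gcongr)
    refine (forEach_within_index (c := 7)
      (fun j (L : List (StepItem K P)) => L.length ≤ k * (2 * D.X.length) + 2 * j) hL
      fun j _ L c _ hL => ?_).mono (by omega) fun L (hL : L.length ≤ _) => by
        rw [Nat.succ_mul]; omega
    refine (forEach_within_index (l := colours) (c := 2)
      (fun q (L : List (StepItem K P)) => L.length ≤ k * (2 * D.X.length) + 2 * j + q) hL
      fun q _ L C _ hL => .op_bind ?_).mono le_rfl fun L hL => hL
    split
    · exact .pure (by omega)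
    · exact .op (by simp; omega)
  dsimp only
  split
  · exact .bind_le (a := d + 6) (hd ▸ redStep_within _ _ _ _ _ _ _)
      (by omega) fun T _ => fin T
  · refine .le (c := i * (g + 4) + 1 + (r * (D.X.length * 8 + 2) + 1) + 1) (.op_bind ?_) (by omega)
    refine .bind ((forEach_within (c := g + 3) (fun _ => True) trivial fun T ρ' _ _ =>
      hg ▸ greenStep_within h _ _ _).le ?_) fun T _ => fin T
    gcongr
    exact hi _

theorem allOneSteps_within [Field K] [LinearOrder K] [DecidableEq P] [Pregroup P]
    {D : Data K P} {r p i : ℕ} (h : ∀ w ∈ D.S, w.size ≤ r) (hD : D.pl.Bounded p i) (m r' : ℕ) :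
    Within (allOneSteps D m r') (m * r' * D.X.length * 2 +
        (p * (computeOneStepTime r D.X.length i + 3) + 1))
      fun O => ∀ key, (O key).length ≤ r * (2 * D.X.length) := by
  unfold allOneSteps
  refine .bind (.newTable _ _) fun O hO => ?_
  have hp := hD.1
  refine (forEach_within (c := computeOneStepTime r D.X.length i + 2)
    (fun O : OneStepTable K P => ∀ key, (O key).length ≤ r * (2 * D.X.length)) (by simp [hO])
    fun O p _ hO => .op_bind ?_).le (by gcongr)
  split
  · exact .bind (computeOneStep_within h hD.2 p) fun L hL =>
      .op (forall_update (Q := fun L : List (StepItem K P) => L.length ≤ r * (2 * D.X.length))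
        hO _ hL)
  · exact .pure hO

/-! ### The test at a place -/

theorem readEntries_within (D : Data K P) (s : Place P) (len : ℕ) (L : EntryTable K P) :
    Within (readEntries D s len L) ((len + 1) * (D.X.length * 8 + 2) + 2) fun _ => True := by
  unfold readEntries
  refine .op_bind (forEach_range_within (fun _ => True) trivial fun M l _ _ =>
    forEach_within (c := 7) (fun _ => True) trivial fun M c _ _ =>
    forEach_colours_within (c := 2) (fun _ => True) trivial fun M C _ => .op_bind ?_)
  split
  · exact .pure trivial
  · exact .op trivial

/-- In each of the `ζ` rounds, at most `2(r + 1)n` entries are inspected, each with a list of at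
most `2rn` items; `readEntries` runs only on failure and goes into the second bound. -/
theorem verifyAtPlace_within [Field K] [LinearOrder K] [DecidableEq P] [Pregroup P]
    {D : Data K P} {r : ℕ} (h : ∀ w ∈ D.S, w.size ≤ r) {O : OneStepTable K P}
    (hO : ∀ key, (O key).length ≤ r * (2 * D.X.length)) (ε : K) (ζ : ℕ) (s : Place P) :
    WithinUntil (verifyAtPlace D O ε ζ s)
      (ζ * ((r + 1) * (D.X.length * (2 * (r * (2 * D.X.length) * 11 + 7) + 2) + 2) + 2) + 2 +
        ((r + 1) * D.X.length * 2) + 2)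
      ((r + 1) * (D.X.length * 8 + 2) + 2) fun _ => True := by
  unfold verifyAtPlace
  refine .le (c := ζ * ((r + 1) * (D.X.length * (2 * (r * (2 * D.X.length) * 11 + 7) + 2) + 2) + 2)
    + 1 + 1 + (r + 1) * D.X.length * 2 + 1 + 1) ?_ (by omega)
  refine .bind (wordAt_within h _) fun R hR => .op_bind ?_
  have hR' : (R.size + 1) * D.X.length * 2 ≤ (r + 1) * D.X.length * 2 := by gcongr
  refine .bind ((Within.newTable _ _).le hR') fun L _ => .op_bind ?_
  refine .le (c := 0 + (ζ * ((r + 1) * (D.X.length * (2 * (r * (2 * D.X.length) * 11 + 7) + 2) + 2)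
    + 2) + 1)) (.bind_until (I := fun _ => True) ?_ ?_ ?_) (by omega)
  rotate_left
  · exact fun _ => rfl
  · exact fun _ _ => .pure_ok trivial
  refine (forUntil_within (c := (r + 1) * (D.X.length * (2 * (r * (2 * D.X.length) * 11 + 7) + 2)
    + 2) + 1) (fun _ => True) trivial fun L i₀ _ _ => ?_).le (by simp)
  refine (forUntil_within (c := D.X.length * (2 * (r * (2 * D.X.length) * 11 + 7) + 2) + 1)
    (fun _ => True) trivial fun L l _ _ => ?_).le (by simp; gcongr)
  refine forUntil_within (fun _ => True) trivial fun L c _ _ => ?_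
  refine (forUntil_within (c := r * (2 * D.X.length) * 11 + 6)
    (fun _ => True) trivial fun L C _ _ => ?_).le (by simp [colours])
  refine .op_bind (.op_bind ?_)
  split
  · exact .pure_ok trivial
  refine .op_bind ?_
  split
  · refine .op_bind (.op_bind ?_)
    refine (forUntil_within (c := 10) (fun _ => True) trivial fun L it _ _ => ?_).le
      (by have := hO (s.loc.rel, (s.loc.pos + l) % D.roots.getD s.loc.rel 0, c, C); omega)
    refine .op_bind (.op_bind ?_)
    split
    · refine .op_bind (.op_bind (.op_bind (.op_bind (.op_bind ?_))))
      split
      · exact .pure_ok trivial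
      split
      · exact .bind_error ((readEntries_within D s R.size L).le (by gcongr))
      · refine .op_bind (.op_bind_any fun better => ?_)
        split
        · exact .op_bind (.pure_ok trivial)
        · exact .pure_ok trivial
    · exact .pure_ok trivial
  · exact .pure_ok trivial

/-! ### The whole procedure -/

theorem PregroupPresentation.length_le_maxLength [Pregroup P] (𝔓 : PregroupPresentation P)
    {w : List P} (hw : w ∈ 𝔓.relators) : w.length ≤ 𝔓.maxLength := by
  unfold PregroupPresentation.maxLength
  generalize 𝔓.relators = l at hw ⊢
  induction l with
  | nil => cases hw
  | cons u l ih =>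
    rcases List.mem_cons.1 hw with rfl | hw
    · exact le_max_left _ _
    · exact (ih hw).trans (le_max_right _ _)

/-- If all relators are empty there is at most one of them, since relators are not repeated.  This
covers the case in which the second summand of the time bound vanishes. -/
theorem PregroupPresentation.length_relators_le_one [Pregroup P] (𝔓 : PregroupPresentation P)
    (h : 𝔓.maxLength = 0) : 𝔓.relators.length ≤ 1 := by
  have hsub : 𝔓.relators ⊆ [[]] := fun w hw =>
    List.mem_singleton.2 (List.eq_nil_of_length_eq_zero
      (Nat.le_zero.1 (h ▸ 𝔓.length_le_maxLength hw)))
  simpa using (𝔓.relators_nodup.subperm hsub).length_le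

theorem PregroupPresentation.maxLength_eq_zero [Pregroup P] (𝔓 : PregroupPresentation P)
    (h : 𝔓.relators.length = 0) : 𝔓.maxLength = 0 := by
  simp [maxLength, List.eq_nil_of_length_eq_zero h]

/-- A bound on the time of `verifyAtPlace` with relators of length at most `r`, `n` letters and `ζ`
steps, not counting the output of the list on failure. -/
def verifyAtPlaceTime (r n ζ : ℕ) : ℕ :=
  ζ * ((r + 1) * (n * (2 * (r * (2 * n) * 11 + 7) + 2) + 2) + 2) + 2 + ((r + 1) * n * 2) + 2

/-- A bound on the time of everything that precedes the tests at the places, for `m` relators of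
length at most `r` and `n` letters.  The summands stand in reverse order of execution;
`2 * m` bounds `|𝓡^±|`, `2 * m * r` the number of locations and `2 * m * r * (2 * n)` the number of places. -/
def preprocessingTime (m r n : ℕ) : ℕ :=
  (m * r * n * 2 + (2 * m * r * (2 * n) * (computeOneStepTime r n (2 * m * r) + 3) + 1)) +
  (n ^ 3 + 6304 * 5 * n ^ 5) +
  (n + (2 * m * (3 * r + 3) + 1)) +
  ((n ^ 2 * 2 + (n * (n * (2 * (n ^ 2 * 2 + (n ^ 2 * 2 + ((14 * n + 4) +
    ((4 * (2 * n ^ 2) + 1) * (14 * n + 7) + 1))) + 3) + 2) + 2) + 1)) +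
    (n ^ 4 * 4 + (n * (n * (n * (2 * (n * 14 + 3) + 2) + 5) + 2) + 1))) +
  (n ^ 2 * 2 + (n ^ 2 + ((2 * m * r * 4 + 1) + ((n * (n * 3 + 2) + 1) + (n ^ 3 * 4 +
    ((2 * m * r * (2 * n) * 3 + 1) + (n * (n * (n * 7 + 3) + 2) + 1))))))) +
  (2 * m * r * n * 2 + (2 * m * r * n +
    (2 * m * r * (2 * m * r * (5 * r + 7) + n * (3 * (2 * m * r) + 9) + 4) + 1))) +
  (2 * m * (r * (4 * r + 5) + 4 * r + 5) + 1) +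
  (n * n + (n * (n * (5 * n + 6) + 2) + 1)) +
  (m * (4 * r + 5 + 2 * m * (4 * r + 5)) + 1) +
  (3 * m + 1) +
  (m * (2 * r + 3) + 1)

/-- The time of the whole procedure as an explicit polynomial: one summand for the tests at all
places and one for the preprocessing, with a separate allowance for writing out the list on failure. -/
theorem RSymVerify_within [DecidableEq P] [Pregroup P] [Field K] [LinearOrder K]
    [IsStrictOrderedRing K] [FloorRing K] (𝔓 : PregroupPresentation P) (hX : 𝔓.letters ≠ [])
    (ε : K) {m r n : ℕ} (hm : 𝔓.relators.length = m) (hr : 𝔓.maxLength = r)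
    (hn : 𝔓.letters.length = n) :
    WithinUntil (RSymVerify 𝔓 ε)
      (2 * m * r * (2 * n) * (verifyAtPlaceTime r n (⌈6 * (1 + ε)⌉₊ - 1) + 2) + 1 + 1 +
        preprocessingTime m r n)
      ((r + 1) * (n * 8 + 2) + 2) fun _ => True := by
  unfold RSymVerify preprocessingTime
  subst hn
  dsimp only
  -- The cost of the final loop is hidden so that the rewriting reassociates only the preprocessing.
  generalize hF : 2 * m * r * (2 * 𝔓.letters.length) *
    (verifyAtPlaceTime r 𝔓.letters.length (⌈6 * (1 + ε)⌉₊ - 1) + 2) + 1 + 1 = F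
  iterate 10 rw [← Nat.add_assoc F]
  refine .bind ((loadRelators_within fun w hw => hr ▸ 𝔓.length_le_maxLength hw).le
    (by rw [hm])) fun A hA => ?_
  obtain ⟨hAm, hAr⟩ := hA
  rw [hm] at hAm
  refine .bind ((longest_within hAr).le (by rw [hAm])) fun r' hr' => ?_
  refine .bind ((symmetrise_within hAr).le (by rw [hAm])) fun S hS => ?_
  rw [hAm] at hS
  obtain ⟨hSm, hSr⟩ := hS
  refine .bind (intermultTable_within _) fun im _ => ?_
  refine .bind ((findLocations_within hSr).le (by gcongr)) ?_
  rintro ⟨roots, locs⟩ hlocs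
  replace hlocs : locs.length ≤ 2 * m * r := hlocs.trans (by gcongr)
  dsimp only
  refine .bind ((findPlaces_within _ hSr r' im locs).le (by gcongr)) fun pl hpl => ?_
  replace hpl : pl.Bounded (2 * m * r * (2 * 𝔓.letters.length)) (2 * m * r) :=
    ⟨hpl.1.trans (by gcongr), fun key => (hpl.2 key).trans hlocs⟩
  have hpl' := hpl.1
  refine .bind ((vertexGraph_within _ im locs pl.places).le (by gcongr)) fun G _ => ?_
  refine .bind (vertexTable_within _ G) fun vert _ => ?_
  refine .bind ((rLetters_within _ hSr).le (by gcongr)) fun rl _ => ?_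
  refine .bind (findBlobs_within hX im rl) fun blobs _ => ?_
  refine .bind ((allOneSteps_within (D := ⟨𝔓.letters, S, roots, im, pl, vert, rl, blobs⟩) hSr hpl
    A.size r').le (by rw [hAm]; dsimp only; gcongr)) fun O hO => ?_
  subst hF
  refine .op_bind ?_
  refine (forUntil_within (c := verifyAtPlaceTime r 𝔓.letters.length (⌈6 * (1 + ε)⌉₊ - 1) + 1)
    (fun _ => True) trivial fun _ s _ _ => .op_bind ?_).le (by gcongr)
  split
  · refine (verifyAtPlace_within
      (D := ⟨𝔓.letters, S, roots, im, pl, vert, rl, blobs⟩) hSr hO ε _ s).le ?_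
    unfold verifyAtPlaceTime
    gcongr
    exact min_le_left _ _
  · exact .pure_ok trivial

/-! ### Comparison with the claimed bound -/

/-- Every monomial of degree at most `2` in `m`, `3` in `r` and `4` in `n` is at most the claimed
bound, also in the degenerate cases `m = 0` and `r = 0`. -/
theorem monomial_le {m r n : ℕ} (hn : 1 ≤ n) (hm : r = 0 → m ≤ 1) (hr : m = 0 → r = 0)
    (a : Fin 3) (b : Fin 4) (c : Fin 5) :
    m ^ (a : ℕ) * r ^ (b : ℕ) * n ^ (c : ℕ) ≤ n ^ 5 + r ^ 3 * n ^ 4 * m ^ 2 := by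
  rcases Nat.eq_zero_or_pos r with rfl | hr0
  · have h1 : m ^ (a : ℕ) * 0 ^ (b : ℕ) ≤ 1 :=
      mul_le_one' (pow_le_one' (hm rfl) _) (pow_le_one' (Nat.zero_le 1) _)
    calc _ ≤ 1 * n ^ 5 := Nat.mul_le_mul h1 (Nat.pow_le_pow_right hn (by omega))
      _ ≤ _ := by rw [one_mul]; exact Nat.le_add_right _ _
  · have hm0 : 0 < m := Nat.pos_of_ne_zero fun h => hr0.ne' (hr h)
    calc _ ≤ m ^ 2 * r ^ 3 * n ^ 4 := by gcongr <;> omega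
      _ = r ^ 3 * n ^ 4 * m ^ 2 := by ring
      _ ≤ _ := Nat.le_add_left _ _

theorem preprocessingTime_le {m r n T : ℕ} (h5 : n ^ 5 ≤ T)
    (h : ∀ (a : Fin 3) (b : Fin 4) (c : Fin 5), m ^ (a : ℕ) * r ^ (b : ℕ) * n ^ (c : ℕ) ≤ T) :
    preprocessingTime m r n + ((r + 1) * (n * 8 + 2) + 2) ≤ 50000 * T := by
  unfold preprocessingTime computeOneStepTime
  simp [Fin.forall_fin_succ] at h
  -- Both sides become linear in the monomials; the constant is at least the sum of the coefficients.
  ring_nf at h ⊢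
  omega

theorem verificationTime_le {m r n T : ℕ} (ζ : ℕ)
    (h : ∀ (a : Fin 3) (b : Fin 4) (c : Fin 5), m ^ (a : ℕ) * r ^ (b : ℕ) * n ^ (c : ℕ) ≤ T) :
    2 * m * r * (2 * n) * (verifyAtPlaceTime r n ζ + 2) + 1 + 1 ≤ 1000 * (ζ + 1) * T := by
  unfold verifyAtPlaceTime
  -- The cost is linear in `ζ`: its coefficients are compared with `T` and with `ζ * T`.
  have h' : ∀ (a : Fin 3) (b : Fin 4) (c : Fin 5),
    ζ * (m ^ (a : ℕ) * r ^ (b : ℕ) * n ^ (c : ℕ)) ≤ ζ * T := fun a b c => by gcongr; exact h a b c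
  simp [Fin.forall_fin_succ] at h
  simp only [Fin.forall_fin_succ, Fin.forall_fin_zero] at h'
  simp only [Fin.val_succ, Fin.val_zero] at h'
  ring_nf at h h' ⊢
  omega

end RSym

theorem theorem7p16 :
    ∃ C : ℝ, ∀ (P : Type) [DecidableEq P] [RSym.Pregroup P] (𝔓 : RSym.PregroupPresentation P)
      (ε : ℝ), 𝔓.letters ≠ [] → 0 < ε →
      ((RSym.RSymVerify 𝔓 ε).time : ℝ) ≤ C * (1 + ε) *
        ((𝔓.letters.length : ℝ) ^ 5 +
          (𝔓.maxLength : ℝ) ^ 3 * (𝔓.letters.length : ℝ) ^ 4 * (𝔓.relators.length : ℝ) ^ 2) := by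
  -- Since `ζ ≤ 6 * (1 + ε)`, the constant is `6 * 1000 + 1000 + 50000`.
  refine ⟨57000, fun P _ _ 𝔓 ε hX hε => ?_⟩
  have hmono := RSym.monomial_le (List.length_pos_iff.2 hX) 𝔓.length_relators_le_one
    𝔓.maxLength_eq_zero
  have hT := Nat.le_add_right (𝔓.letters.length ^ 5)
    (𝔓.maxLength ^ 3 * 𝔓.letters.length ^ 4 * 𝔓.relators.length ^ 2)
  have h1 := (RSym.RSymVerify_within 𝔓 hX ε rfl rfl rfl).time_le
  have h2 := RSym.preprocessingTime_le hT hmono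
  have h3 := RSym.verificationTime_le (⌈6 * (1 + ε)⌉₊ - 1) hmono
  have hζ : ((⌈6 * (1 + ε)⌉₊ - 1 : ℕ) : ℝ) ≤ 6 * (1 + ε) := by
    have h4 := Nat.ceil_lt_add_one (a := 6 * (1 + ε)) (by positivity)
    have h5 : 1 ≤ ⌈6 * (1 + ε)⌉₊ := Nat.one_le_ceil_iff.2 (by positivity)
    rw [Nat.cast_sub h5, Nat.cast_one]
    linarith
  generalize ⌈6 * (1 + ε)⌉₊ - 1 = ζ at *
  have h6 : ((RSym.RSymVerify 𝔓 ε).time : ℝ) ≤ (1000 * ((ζ : ℝ) + 1) + 50000) *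
      ((𝔓.letters.length : ℝ) ^ 5 +
        (𝔓.maxLength : ℝ) ^ 3 * (𝔓.letters.length : ℝ) ^ 4 * (𝔓.relators.length : ℝ) ^ 2) := by
    have : (RSym.RSymVerify 𝔓 ε).time ≤ (1000 * (ζ + 1) + 50000) * (𝔓.letters.length ^ 5 +
        𝔓.maxLength ^ 3 * 𝔓.letters.length ^ 4 * 𝔓.relators.length ^ 2) := by
      rw [Nat.add_mul]
      omega
    exact_mod_cast this
  refine h6.trans (mul_le_mul_of_nonneg_right ?_ (by positivity))
  linarith
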